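/- Let $\mathcal{C}$ be an additive category with two exact structures in the sense of Quillen, given by classes of conflations $\mathbf{E}\subseteq\mathbf{E}'$. Write $\mathcal{C}_{\mathbf{E}}$, $\mathcal{C}_{\mathbf{E}'}$ for the resulting exact categories. Call the first (second) map of a conflation an inflation (deflation). Assume that $\mathcal{C}_{\mathbf{E}'}$ is efficient, that is: (Ax1) arbitrary transfinite compositions of inflations exist and are inflations; (Ax2) every object $X$ is small relative to inflations: there is an infinite regular cardinal $\kappa$ such that for each ordinal $\lambda$ of cofinality $\geq\kappa$ and each $\lambda$-sequence $(Y_\alpha)_{\alpha<\lambda}$ (continuous at limit steps) of inflations whose colimit exists, the map $\operatorname{colim}_\alpha\mathrm{Hom}(X,Y_\alpha)\to\mathrm{Hom}(X,\operatorname{colim}_\alpha Y_\alpha)$ is an isomorphism; (Ax3) for each set $\mathcal{S}$ of objects there is a set $\mathcal{I}$ of inflations such that the class $\mathrm{Coker}(\mathcal{I})$ of all cokernels of maps in $\mathcal{I}$ is the class of objects isomorphic to objects of $\mathcal{S}$, and $\mathcal{I}$ is strongly homological: for every conflation $0\to A\to B\to S\to0$ with $S\in\mathrm{Coker}(\mathcal{I})$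 there are a conflation $0\to A'\xrightarrow{i}B'\to S\to0$ with $i\in\mathcal{I}$ and a morphism from it to the given conflation which is the identity on $S$. Assume that $\mathcal{C}_{\mathbf{E}}$ is Frobenius: it has enough projectives and enough injectives, and these coincide. Let $\underline{\mathcal{C}}_{\mathbf{E}}$ be its stable category modulo projectives, triangulated with suspension $[1]=\Omega_{\mathbf{E}}^{-1}$. For a class $\mathcal{X}$ of objects of $\mathcal{C}$, let $\underline{\mathcal{X}}$ be its essential image in $\underline{\mathcal{C}}_{\mathbf{E}}$, and let $\Omega_{\mathbf{E}}^{-1}(\mathcal{X})$ be the class of all $Z$ that occur in a conflation $0\to X\to I\to Z\to 0$ in $\mathbf{E}$ with $X\in\mathcal{X}$ and $I$ $\mathbf{E}$-injective. Let $\mathcal{S}$ be a set of objects of $\mathcal{C}$ and let $\mathcal{F}$ be the class of $\mathcal{S}$-filtered objects of $\mathcal{C}_{\mathbf{E}'}$, i.e. of those $X$ for which $0\to X$ is a transfinite composition of $\mathbf{E}'$-inflations with cokernels in $\mathcal{S}$. Let $\underline{\mathcal{F}}^{\perp}$ be the class of objects $Y$ with $\mathrm{Hom}_{\underline{\mathcal{C}}_{\mathbf{E}}}(F,Y)=0$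 for all $F\in\underline{\mathcal{F}}$. 1. If $\underline{\Omega_{\mathbf{E}}^{-1}(\mathcal{F})}\subseteq\underline{\mathcal{F}}$, then $(\underline{\mathcal{F}},\underline{\mathcal{F}}^{\perp}[1])$ is a t-structure in $\underline{\mathcal{C}}_{\mathbf{E}}$. 2. If $\underline{\Omega_{\mathbf{E}}^{-1}(\mathcal{F})}=\underline{\mathcal{F}}$, then $(\underline{\mathcal{F}},\underline{\mathcal{F}}^{\perp}[1])$ is a Bousfield localizing pair in $\underline{\mathcal{C}}_{\mathbf{E}}$. Here a pair $(\mathcal{X},\mathcal{Y})$ of full subcategories is a t-structure if $(\mathcal{X}[1])^{\perp}=\mathcal{Y}$ and $\mathcal{X}[1]={}^{\perp}\mathcal{Y}$, if $\mathcal{X}[1]\subseteq\mathcal{X}$, and if each object $M$ lies in a distinguished triangle $X[1]\to M\to Y\to X[2]$ with $X\in\mathcal{X}$ and $Y\in\mathcal{Y}$. It is a Bousfield localizing pair if moreover $\mathcal{X}=\mathcal{X}[1]$. -/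

import Mathlib

open CategoryTheory Limits ZeroObject

universe v u

/-- An exact structure (in the sense of Quillen) on an additive category `C`: a class of
kernel-cokernel pairs, the conflations, closed under isomorphism and subject to the usual axioms.
The first (resp. second) map of a conflation is called an inflation (resp. a deflation). -/
structure ExactStructure (C : Type u) [Category.{v} C] [Preadditive C] [HasZeroObject C]
    [HasBinaryBiproducts C] where
  /-- the class of conflations `0 ⟶ X₁ ⟶ X₂ ⟶ X₃ ⟶ 0` -/
  conflation : ObjectProperty (ShortComplex C)
  conflation_of_iso : ∀ {S T : ShortComplex C}, (S ≅ T) → conflation S → conflation T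
  isKernel : ∀ S : ShortComplex C, conflation S →
    Nonempty (IsLimit (KernelFork.ofι S.f S.zero))
  isCokernel : ∀ S : ShortComplex C, conflation S →
    Nonempty (IsColimit (CokernelCofork.ofπ S.g S.zero))
  /-- identities are inflations -/
  inflation_id : ∀ A : C, ∃ (Z : C) (p : A ⟶ Z) (w : 𝟙 A ≫ p = 0),
    conflation (ShortComplex.mk (𝟙 A) p w)
  /-- identities are deflations -/
  deflation_id : ∀ A : C, ∃ (K : C) (i : K ⟶ A) (w : i ≫ 𝟙 A = 0),
    conflation (ShortComplex.mk i (𝟙 A) w)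
  /-- inflations are closed under composition -/
  inflation_comp : ∀ {A B D : C} (i : A ⟶ B) (j : B ⟶ D),
    (∃ (Z : C) (p : B ⟶ Z) (w : i ≫ p = 0), conflation (ShortComplex.mk i p w)) →
    (∃ (Z : C) (p : D ⟶ Z) (w : j ≫ p = 0), conflation (ShortComplex.mk j p w)) →
    ∃ (Z : C) (p : D ⟶ Z) (w : (i ≫ j) ≫ p = 0), conflation (ShortComplex.mk (i ≫ j) p w)
  /-- deflations are closed under composition -/
  deflation_comp : ∀ {A B D : C} (p : A ⟶ B) (q : B ⟶ D),
    (∃ (K : C) (i : K ⟶ A) (w : i ≫ p = 0), conflation (ShortComplex.mk i p w)) →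
    (∃ (K : C) (i : K ⟶ B) (w : i ≫ q = 0), conflation (ShortComplex.mk i q w)) →
    ∃ (K : C) (i : K ⟶ A) (w : i ≫ p ≫ q = 0), conflation (ShortComplex.mk i (p ≫ q) w)
  /-- pushouts of inflations along arbitrary maps exist and are inflations -/
  inflation_pushout : ∀ {A B A' : C} (i : A ⟶ B) (f : A ⟶ A'),
    (∃ (Z : C) (p : B ⟶ Z) (w : i ≫ p = 0), conflation (ShortComplex.mk i p w)) →
    ∃ (B' : C) (f' : B ⟶ B') (i' : A' ⟶ B'), IsPushout i f f' i' ∧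
      ∃ (Z : C) (p : B' ⟶ Z) (w : i' ≫ p = 0), conflation (ShortComplex.mk i' p w)
  /-- pullbacks of deflations along arbitrary maps exist and are deflations -/
  deflation_pullback : ∀ {B Z Z' : C} (p : B ⟶ Z) (f : Z' ⟶ Z),
    (∃ (K : C) (i : K ⟶ B) (w : i ≫ p = 0), conflation (ShortComplex.mk i p w)) →
    ∃ (B' : C) (f' : B' ⟶ B) (p' : B' ⟶ Z'), IsPullback f' p' p f ∧
      ∃ (K : C) (i : K ⟶ B') (w : i ≫ p' = 0), conflation (ShortComplex.mk i p' w)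

namespace ExactStructure

variable {C : Type u} [Category.{v} C] [Preadditive C] [HasZeroObject C] [HasBinaryBiproducts C]
  (E : ExactStructure C)

/-- `A ⟶ B ⟶ Z` is a conflation. -/
def IsConflation {A B Z : C} (i : A ⟶ B) (p : B ⟶ Z) : Prop :=
  ∃ w : i ≫ p = 0, E.conflation (ShortComplex.mk i p w)

/-- The class of inflations. -/
def inflations : MorphismProperty C := fun _ B i => ∃ (Z : C) (p : B ⟶ Z), E.IsConflation i p

/-- The class of deflations. -/
def deflations : MorphismProperty C := fun A _ p => ∃ (K : C) (i : K ⟶ A), E.IsConflation i p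

/-- The inflations with a cokernel in the class `S`. -/
def inflationsWithCokernelIn (S : ObjectProperty C) : MorphismProperty C :=
  fun _ B i => ∃ (Z : C) (p : B ⟶ Z), E.IsConflation i p ∧ S Z

/-- `Filt S`: the class of objects `X` such that `0 ⟶ X` is a transfinite composition of inflations
with a cokernel in `S`. -/
def filt (S : ObjectProperty C) : ObjectProperty C := fun X =>
  (E.inflationsWithCokernelIn S).transfiniteCompositions.{v} (0 : (0 : C) ⟶ X)

/-! ### Efficient exact categories -/

/-- Transfinite compositions of inflations exist and are inflations. -/
def HasTransfiniteCompositions : Prop :=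
  ∀ (J : Type v) [LinearOrder J] [SuccOrder J] [OrderBot J] [WellFoundedLT J]
    (F : J ⥤ C) [F.IsWellOrderContinuous],
    (∀ j : J, ¬ IsMax j → E.inflations (F.map (homOfLE (Order.le_succ j)))) →
      HasColimit F ∧ ∀ (c : Cocone F), IsColimit c → E.inflations (c.ι.app ⊥)

/-- `X` is `κ`-small relative to the class of morphisms `W`: for every well-ordered sequence `F` of
maps in `W`, continuous at limit stages, of length of cofinality at least `κ` and with a
composition, the map `colim Hom(X, F j) ⟶ Hom(X, colim F j)` is an isomorphism. -/
def IsCardinalSmall (W : MorphismProperty C) (κ : Cardinal.{v}) (X : C) : Prop :=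
  ∀ (J : Type v) [LinearOrder J] [SuccOrder J] [OrderBot J] [WellFoundedLT J]
    (F : J ⥤ C) [F.IsWellOrderContinuous], κ ≤ Order.cof J →
    (∀ j : J, ¬ IsMax j → W (F.map (homOfLE (Order.le_succ j)))) → HasColimit F →
      PreservesColimit F (coyoneda.obj (Opposite.op X))

/-- Every object is small relative to the class of inflations. -/
def HasSmallObjects : Prop :=
  ∀ X : C, ∃ κ : Cardinal.{v}, κ.IsRegular ∧ IsCardinalSmall E.inflations κ X

/-- `Coker I`: the class of objects that are cokernels of inflations in `I`. -/
def coker (I : MorphismProperty C) : ObjectProperty C :=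
  fun Z => ∃ (A B : C) (i : A ⟶ B) (p : B ⟶ Z), I i ∧ E.IsConflation i p

/-- A class `I` of inflations is strongly homological if every conflation `A ⟶ B ⟶ Z` with
`Z ∈ Coker I` receives a map, which is the identity on `Z`, from a conflation `A' ⟶ B' ⟶ Z` whose
inflation belongs to `I`. -/
def IsStronglyHomological (I : MorphismProperty C) : Prop :=
  ∀ {A B Z : C} (j : A ⟶ B) (q : B ⟶ Z), E.IsConflation j q → E.coker I Z →
    ∃ (A' B' : C) (i : A' ⟶ B') (p : B' ⟶ Z) (a : A' ⟶ A) (b : B' ⟶ B),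
      I i ∧ E.IsConflation i p ∧ i ≫ b = a ≫ j ∧ b ≫ q = p

/-- Efficient exact categories. -/
structure IsEfficient : Prop where
  hasTransfiniteCompositions : E.HasTransfiniteCompositions
  hasSmallObjects : E.HasSmallObjects
  exists_stronglyHomological : ∀ (S : ObjectProperty C) [ObjectProperty.Small.{v} S],
    ∃ I : MorphismProperty C, MorphismProperty.IsSmall.{v} I ∧ I ≤ E.inflations ∧
      E.IsStronglyHomological I ∧ E.coker I = S.isoClosure

/-! ### Frobenius exact categories -/

/-- Injective objects: every inflation out of `I` splits. -/
def IsInjective (I : C) : Prop :=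
  ∀ {Y : C} (i : I ⟶ Y), E.inflations i → ∃ r : Y ⟶ I, i ≫ r = 𝟙 I

/-- Projective objects: every deflation onto `P` splits. -/
def IsProjective (P : C) : Prop :=
  ∀ {Y : C} (p : Y ⟶ P), E.deflations p → ∃ s : P ⟶ Y, s ≫ p = 𝟙 P

/-- Frobenius exact categories: there are enough injectives and enough projectives, and the
injective and the projective objects coincide. -/
class IsFrobenius : Prop where
  enough_injectives : ∀ X : C, ∃ (I : C) (i : X ⟶ I), E.IsInjective I ∧ E.inflations i
  enough_projectives : ∀ X : C, ∃ (P : C) (p : P ⟶ X), E.IsProjective P ∧ E.deflations p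
  injective_iff_projective : ∀ X : C, E.IsInjective X ↔ E.IsProjective X

/-- The class of cosyzygies `Ω⁻¹ X` of the objects `X` in the class `F`, i.e. of the objects `Z`
in conflations `0 ⟶ X ⟶ I ⟶ Z ⟶ 0` with `X` in `F` and `I` injective. -/
def cosyzygies (F : ObjectProperty C) : ObjectProperty C :=
  fun Z => ∃ (X I : C) (i : X ⟶ I) (p : I ⟶ Z), F X ∧ E.IsInjective I ∧ E.IsConflation i p

/-! ### The stable category -/

lemma IsProjective.lift {P : C} (hP : E.IsProjective P) {Y Z : C} (p : Y ⟶ Z)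
    (hp : E.deflations p) (f : P ⟶ Z) : ∃ g : P ⟶ Y, g ≫ p = f := by
  obtain ⟨K, i, w, hi⟩ := hp
  obtain ⟨B', f', p', hpb, K', i', w', hi'⟩ := E.deflation_pullback p f ⟨K, i, w, hi⟩
  obtain ⟨s, hs⟩ := hP p' ⟨K', i', w', hi'⟩
  exact ⟨s ≫ f', by rw [Category.assoc, hpb.w, reassoc_of% hs]⟩

lemma IsInjective.extend {I : C} (hI : E.IsInjective I) {X Y : C} (i : X ⟶ Y)
    (hi : E.inflations i) (f : X ⟶ I) : ∃ g : Y ⟶ I, i ≫ g = f := by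
  obtain ⟨Z, p, w, hp⟩ := hi
  obtain ⟨B', f', i', hpo, Z', p', w', hp'⟩ := E.inflation_pushout i f ⟨Z, p, w, hp⟩
  obtain ⟨r, hr⟩ := hI i' ⟨Z', p', w', hp'⟩
  exact ⟨f' ≫ r, by rw [← Category.assoc, hpo.w, Category.assoc, hr, Category.comp_id]⟩

lemma isProjective_zero : E.IsProjective (0 : C) := fun _ _ =>
  ⟨0, (isZero_zero C).eq_of_src _ _⟩

lemma isProjective_biprod {P Q : C} (hP : E.IsProjective P) (hQ : E.IsProjective Q) :
    E.IsProjective (P ⊞ Q) := by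
  intro Y p hp
  obtain ⟨a, ha⟩ := IsProjective.lift E hP p hp biprod.inl
  obtain ⟨b, hb⟩ := IsProjective.lift E hQ p hp biprod.inr
  exact ⟨biprod.desc a b, by ext <;> simp [ha, hb]⟩

/-- Two parallel maps are stably equal if their difference factors through a projective object. -/
def stableRel : HomRel C := fun X Y f g =>
  ∃ (P : C) (a : X ⟶ P) (b : P ⟶ Y), E.IsProjective P ∧ f - g = a ≫ b

lemma stableRel_add {X Y : C} (f₁ f₂ g₁ g₂ : X ⟶ Y) (hf : E.stableRel f₁ f₂)
    (hg : E.stableRel g₁ g₂) : E.stableRel (f₁ + g₁) (f₂ + g₂) := by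
  obtain ⟨P, a, b, hP, h⟩ := hf
  obtain ⟨Q, c, d, hQ, h'⟩ := hg
  refine ⟨P ⊞ Q, biprod.lift a c, biprod.desc b d, E.isProjective_biprod hP hQ, ?_⟩
  rw [biprod.lift_desc, ← h, ← h']
  abel

instance : Congruence E.stableRel where
  comp_left := by
    rintro X Y Z f g g' ⟨P, a, b, hP, h⟩
    exact ⟨P, f ≫ a, b, hP, by rw [← Preadditive.comp_sub, h, Category.assoc]⟩
  comp_right := by
    rintro X Y Z f f' g ⟨P, a, b, hP, h⟩
    exact ⟨P, a, b ≫ g, hP, by rw [← Preadditive.sub_comp, h, Category.assoc]⟩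
  equivalence :=
    { refl := fun f => ⟨0, 0, 0, E.isProjective_zero, by simp⟩
      symm := by
        rintro f g ⟨P, a, b, hP, h⟩
        exact ⟨P, -a, b, hP, by rw [Preadditive.neg_comp, ← h]; abel⟩
      trans := by
        rintro f g k ⟨P, a, b, hP, h⟩ ⟨Q, c, d, hQ, h'⟩
        refine ⟨P ⊞ Q, biprod.lift a c, biprod.desc b d, E.isProjective_biprod hP hQ, ?_⟩
        rw [biprod.lift_desc, ← h, ← h']
        abel }

/-- The stable category of `C` modulo the projective objects. -/
abbrev Stable : Type u := CategoryTheory.Quotient E.stableRel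

/-- The projection functor to the stable category. -/
abbrev toStable : C ⥤ E.Stable := CategoryTheory.Quotient.functor E.stableRel

instance : Preadditive E.Stable :=
  CategoryTheory.Quotient.preadditive E.stableRel (fun _ _ _ _ _ _ => E.stableRel_add _ _ _ _)

/-! ### The suspension functor -/

lemma exists_desc {A B Z T : C} {i : A ⟶ B} {p : B ⟶ Z} (h : E.IsConflation i p) (k : B ⟶ T)
    (hk : i ≫ k = 0) : ∃ l : Z ⟶ T, p ≫ l = k := by
  obtain ⟨w, h⟩ := h
  obtain ⟨hc⟩ := E.isCokernel _ h
  exact ⟨hc.desc (CokernelCofork.ofπ k hk),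
    hc.fac (CokernelCofork.ofπ k hk) WalkingParallelPair.one⟩

lemma epi_of_isConflation {A B Z : C} {i : A ⟶ B} {p : B ⟶ Z} (h : E.IsConflation i p) :
    Epi p := by
  obtain ⟨w, h⟩ := h
  obtain ⟨hc⟩ := E.isCokernel _ h
  exact ⟨fun g k hgk => Cofork.IsColimit.hom_ext hc hgk⟩

section Suspension

variable [E.IsFrobenius]

lemma exists_injective_conflation (X : C) :
    ∃ (I Z : C) (i : X ⟶ I) (p : I ⟶ Z), E.IsInjective I ∧ E.IsConflation i p := by
  obtain ⟨I, i, hI, Z, p, h⟩ := IsFrobenius.enough_injectives (E := E) X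
  exact ⟨I, Z, i, p, hI, h⟩

/-- A chosen injective object `I(X)` containing `X`. -/
noncomputable def inj (X : C) : C := (E.exists_injective_conflation X).choose

/-- The chosen cosyzygy `Ω⁻¹ X`. -/
noncomputable def cosyz (X : C) : C := (E.exists_injective_conflation X).choose_spec.choose

/-- The chosen inflation `X ⟶ I(X)`. -/
noncomputable def injι (X : C) : X ⟶ E.inj X :=
  (E.exists_injective_conflation X).choose_spec.choose_spec.choose

/-- The chosen deflation `I(X) ⟶ Ω⁻¹ X`. -/
noncomputable def injπ (X : C) : E.inj X ⟶ E.cosyz X :=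
  (E.exists_injective_conflation X).choose_spec.choose_spec.choose_spec.choose

lemma isInjective_inj (X : C) : E.IsInjective (E.inj X) :=
  (E.exists_injective_conflation X).choose_spec.choose_spec.choose_spec.choose_spec.1

lemma isConflation_inj (X : C) : E.IsConflation (E.injι X) (E.injπ X) :=
  (E.exists_injective_conflation X).choose_spec.choose_spec.choose_spec.choose_spec.2

/-- `b` is induced on the chosen cosyzygies by some extension of `f` to the chosen injectives. -/
def IsCosyzMap {X Y : C} (f : X ⟶ Y) (b : E.cosyz X ⟶ E.cosyz Y) : Prop :=
  ∃ a : E.inj X ⟶ E.inj Y, E.injι X ≫ a = f ≫ E.injι Y ∧ E.injπ X ≫ b = a ≫ E.injπ Y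

lemma exists_isCosyzMap {X Y : C} (f : X ⟶ Y) : ∃ b, E.IsCosyzMap f b := by
  obtain ⟨a, ha⟩ := IsInjective.extend E (E.isInjective_inj Y) (E.injι X)
    ⟨_, _, E.isConflation_inj X⟩ (f ≫ E.injι Y)
  obtain ⟨w, -⟩ := E.isConflation_inj Y
  obtain ⟨b, hb⟩ := E.exists_desc (E.isConflation_inj X) (a ≫ E.injπ Y)
    (by rw [reassoc_of% ha, w, comp_zero])
  exact ⟨b, a, ha, hb⟩

/-- Stably equal maps induce stably equal maps on cosyzygies. -/
lemma IsCosyzMap.stableRel {X Y : C} {f f' : X ⟶ Y} {b b' : E.cosyz X ⟶ E.cosyz Y}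
    (h : E.IsCosyzMap f b) (h' : E.IsCosyzMap f' b') (hf : E.stableRel f f') :
    E.stableRel b b' := by
  obtain ⟨a, ha, hb⟩ := h
  obtain ⟨a', ha', hb'⟩ := h'
  obtain ⟨P, s, t, hP, hst⟩ := hf
  obtain ⟨s', hs'⟩ := IsInjective.extend E
    ((IsFrobenius.injective_iff_projective (E := E) P).2 hP) (E.injι X)
    ⟨_, _, E.isConflation_inj X⟩ s
  obtain ⟨w, -⟩ := E.isConflation_inj Y
  obtain ⟨d, hd⟩ := E.exists_desc (E.isConflation_inj X) (a - a' - s' ≫ t ≫ E.injι Y) (by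
    rw [Preadditive.comp_sub, Preadditive.comp_sub, ha, ha', reassoc_of% hs',
      ← Preadditive.sub_comp, hst, Category.assoc, sub_self])
  refine ⟨E.inj Y, d, E.injπ Y,
    (IsFrobenius.injective_iff_projective (E := E) _).1 (E.isInjective_inj Y), ?_⟩
  have := E.epi_of_isConflation (E.isConflation_inj X)
  rw [← cancel_epi (E.injπ X), Preadditive.comp_sub, hb, hb', reassoc_of% hd]
  simp [w]

/-- `Ω⁻¹` as a functor from `C` to its stable category. -/
noncomputable def preSuspension : C ⥤ E.Stable where
  obj X := E.toStable.obj (E.cosyz X)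
  map f := E.toStable.map (E.exists_isCosyzMap f).choose
  map_id X := by
    rw [← E.toStable.map_id]
    refine CategoryTheory.Quotient.sound _ (IsCosyzMap.stableRel E
      (E.exists_isCosyzMap (𝟙 X)).choose_spec ⟨𝟙 _, by simp, by simp⟩
      (Congruence.equivalence.refl (𝟙 X)))
  map_comp {X Y Z} f g := by
    rw [← E.toStable.map_comp]
    obtain ⟨a, ha, hb⟩ := (E.exists_isCosyzMap f).choose_spec
    obtain ⟨a', ha', hb'⟩ := (E.exists_isCosyzMap g).choose_spec
    refine CategoryTheory.Quotient.sound _ (IsCosyzMap.stableRel E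
      (E.exists_isCosyzMap (f ≫ g)).choose_spec ⟨a ≫ a', ?_, ?_⟩
      (Congruence.equivalence.refl (f ≫ g)))
    · rw [reassoc_of% ha, ha', Category.assoc]
    · rw [reassoc_of% hb, hb', Category.assoc]

/-- The suspension functor `?[1] = Ω⁻¹` of the stable category. -/
noncomputable def suspension : E.Stable ⥤ E.Stable :=
  CategoryTheory.Quotient.lift E.stableRel E.preSuspension (fun _ _ _ _ h =>
    CategoryTheory.Quotient.sound _ (IsCosyzMap.stableRel E
      (E.exists_isCosyzMap _).choose_spec (E.exists_isCosyzMap _).choose_spec h))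

/-- The triangles `A ⟶ B ⟶ D ⟶ A[1]` of the stable category: those isomorphic to a standard
triangle `X ⟶ Y ⟶ Z ⟶ Ω⁻¹ X`, where `u : X ⟶ Y` is a map of `C`, the object `Z` is the pushout of
`u` and `X ⟶ I(X)`, and `w : Z ⟶ Ω⁻¹ X` is zero on `Y` and is the given deflation on `I(X)`. -/
def IsTriangle {A B D : E.Stable} (f : A ⟶ B) (g : B ⟶ D) (h : D ⟶ E.suspension.obj A) : Prop :=
  ∃ (X Y Z : C) (u : X ⟶ Y) (v : Y ⟶ Z) (j : E.inj X ⟶ Z) (w : Z ⟶ E.cosyz X)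
    (e₁ : A ≅ E.toStable.obj X) (e₂ : B ≅ E.toStable.obj Y) (e₃ : D ≅ E.toStable.obj Z),
    IsPushout u (E.injι X) v j ∧ v ≫ w = 0 ∧ j ≫ w = E.injπ X ∧
    f ≫ e₂.hom = e₁.hom ≫ E.toStable.map u ∧
    g ≫ e₃.hom = e₂.hom ≫ E.toStable.map v ∧
    h ≫ E.suspension.map e₁.hom = e₃.hom ≫ E.toStable.map w

/-! ### t-structures -/

/-- `(𝓧, 𝓨)` is a t-structure in the stable category. Here `𝓧[1]` is `𝓧.map E.suspension`, the
essential image of `𝓧` under the suspension. -/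
structure IsTStructure (𝓧 𝓨 : ObjectProperty E.Stable) : Prop where
  /-- `(𝓧[1], 𝓨)` is a Hom-orthogonal pair. -/
  rightOrthogonal_eq : (𝓧.map E.suspension).rightOrthogonal = 𝓨
  eq_leftOrthogonal : 𝓧.map E.suspension = 𝓨.leftOrthogonal
  shift_le : 𝓧.map E.suspension ≤ 𝓧
  exists_triangle : ∀ M : E.Stable, ∃ (X Y : E.Stable) (f : E.suspension.obj X ⟶ M) (g : M ⟶ Y)
    (h : Y ⟶ E.suspension.obj (E.suspension.obj X)), 𝓧 X ∧ 𝓨 Y ∧ E.IsTriangle f g h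

/-- `(𝓧, 𝓨)` is a Bousfield localizing pair in the stable category: a t-structure with
`𝓧 = 𝓧[1]`. -/
structure IsBousfieldLocalizingPair (𝓧 𝓨 : ObjectProperty E.Stable) : Prop extends
    E.IsTStructure 𝓧 𝓨 where
  eq_shift : 𝓧 = 𝓧.map E.suspension

end Suspension

end ExactStructure

/-! The aisle is produced by a small object argument carried out in `E'`, and the t-structure is
then checked by hand with conflations of `E`. Over a fixed object K, missing extensions along a
strongly homological set I with cokernels S are adjoined to 0 → K. The result is a map f : X → K
with X filtered by S which has the right lifting property against I. Every inflation with cokernel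
in S is a pushout of a member of I, and an inflation with an S-filtered cokernel is a transfinite
composition of inflations with cokernels in S. Hence f lifts against all `E'`-inflations, and so all
`E`-inflations, with cokernel in the class F of filtered objects (`IsEfficient.exists_filt_rlp`,
`IsConflation.hasLiftingProperty`). The suspension is an equivalence, so any M is stably Ω⁻¹K for
some K. Let Z be the cone of Ω⁻¹f : Ω⁻¹X → Ω⁻¹K. For G in F, a map Ω⁻¹G → Z followed by Z → Ω⁻²X
corresponds to a map φ : G → Ω⁻¹X killed by Ω⁻¹f. Such a φ classifies an extension of G by X over
which f extends; lifting splits it, so φ = 0. The map therefore comes from some Ω⁻¹G → Ω⁻¹K, that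
is, from G → K, which lifts through f and so dies in Z. Thus Z is orthogonal to F[1], and Ω⁻¹X → M →
Z is the required triangle (`toStable_map_cone_eq_zero`, `isTStructure_of_rlp`). If M is left
orthogonal to the coaisle, then M → Z is stably zero. Since F[1] ⊆ F also kills Ω⁻²X → Z, the cone Z
is projective and M is isomorphic to Ω⁻¹X. -/

namespace ExactStructure

/-! ### Calculus of conflations: pushouts, pullbacks, the short five lemma, colimits of pullbacks.
-/

section Conflations

variable {C : Type u} [Category.{v} C] [Preadditive C] [HasZeroObject C] [HasBinaryBiproducts C]
  {E : ExactStructure C}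

namespace IsConflation

variable {A B Z : C} {i : A ⟶ B} {p : B ⟶ Z}

lemma zero (h : E.IsConflation i p) : i ≫ p = 0 := h.1

lemma epi (h : E.IsConflation i p) : Epi p := E.epi_of_isConflation h

lemma exists_lift (h : E.IsConflation i p) {T : C} (k : T ⟶ B) (hk : k ≫ p = 0) :
    ∃ l : T ⟶ A, l ≫ i = k := by
  obtain ⟨w, h⟩ := h
  obtain ⟨hc⟩ := E.isKernel _ h
  exact ⟨hc.lift (KernelFork.ofι k hk), hc.fac (KernelFork.ofι k hk) WalkingParallelPair.zero⟩

lemma mono (h : E.IsConflation i p) : Mono i := by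
  obtain ⟨w, h⟩ := h
  obtain ⟨hc⟩ := E.isKernel _ h
  exact ⟨fun g k hgk => Fork.IsLimit.hom_ext hc hgk⟩

lemma of_iso (h : E.IsConflation i p) {A' B' Z' : C} {i' : A' ⟶ B'} {p' : B' ⟶ Z'}
    (a : A ≅ A') (b : B ≅ B') (z : Z ≅ Z') (h₁ : a.hom ≫ i' = i ≫ b.hom)
    (h₂ : b.hom ≫ p' = p ≫ z.hom) : E.IsConflation i' p' := by
  obtain ⟨w, h⟩ := h
  have w' : i' ≫ p' = 0 := by
    rw [← cancel_epi a.hom, reassoc_of% h₁, h₂, reassoc_of% w]; simp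
  exact ⟨w', E.conflation_of_iso (ShortComplex.isoMk a b z h₁ h₂) h⟩

/-- Any kernel of a deflation is an inflation. -/
lemma of_kernel (h : E.IsConflation i p) {A' : C} {i' : A' ⟶ B} [Mono i'] (w : i' ≫ p = 0)
    (hl : ∃ l : A ⟶ A', l ≫ i' = i) : E.IsConflation i' p := by
  obtain ⟨l, hl⟩ := hl
  obtain ⟨m, hm⟩ := h.exists_lift i' w
  have := h.mono
  refine h.of_iso ⟨l, m, ?_, ?_⟩ (Iso.refl _) (Iso.refl _) (by simpa using hl) (by simp)
  · rw [← cancel_mono i, Category.assoc, hm, hl, Category.id_comp]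
  · rw [← cancel_mono i', Category.assoc, hl, hm, Category.id_comp]

/-- Any cokernel of an inflation is a deflation. -/
lemma of_cokernel (h : E.IsConflation i p) {Z' : C} {p' : B ⟶ Z'} [Epi p'] (w : i ≫ p' = 0)
    (hl : ∃ l : Z' ⟶ Z, p' ≫ l = p) : E.IsConflation i p' := by
  obtain ⟨l, hl⟩ := hl
  obtain ⟨m, hm⟩ := E.exists_desc h p' w
  have := h.epi
  refine h.of_iso (Iso.refl _) (Iso.refl _) ⟨m, l, ?_, ?_⟩ (by simp) (by simpa using hm.symm)
  · rw [← cancel_epi p, reassoc_of% hm, hl, Category.comp_id]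
  · rw [← cancel_epi p', reassoc_of% hl, hm, Category.comp_id]

/-- The pushout of a conflation is a conflation with the same cokernel. -/
lemma of_isPushout (h : E.IsConflation i p) {A' B' : C} {f : A ⟶ A'} {f' : B ⟶ B'}
    {i' : A' ⟶ B'} (sq : IsPushout i f f' i') {p' : B' ⟶ Z} (h₁ : i' ≫ p' = 0)
    (h₂ : f' ≫ p' = p) : E.IsConflation i' p' := by
  obtain ⟨B₁, f₁, i₁, sq₁, Z₁, p₁, h'⟩ := E.inflation_pushout i f ⟨Z, p, h⟩
  obtain ⟨e, he₁, he₂⟩ : ∃ e : B₁ ≅ B', f₁ ≫ e.hom = f' ∧ i₁ ≫ e.hom = i' :=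
    ⟨sq₁.isoIsPushout _ _ sq, by simp, by simp⟩
  have h'' : E.IsConflation i' (e.inv ≫ p₁) :=
    of_iso h' (Iso.refl _) e (Iso.refl _) (by simp [he₂]) (by simp)
  have := h.epi
  have : Epi p' := epi_of_epi_fac h₂
  refine h''.of_cokernel h₁ ?_
  obtain ⟨l, hl⟩ := E.exists_desc h (f' ≫ e.inv ≫ p₁) (by
    rw [reassoc_of% sq.w, h''.zero, comp_zero])
  refine ⟨l, sq.hom_ext (by rw [reassoc_of% h₂, hl]) (by rw [reassoc_of% h₁, h''.zero, zero_comp])⟩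

/-- Pushouts of conflations along arbitrary maps exist. -/
lemma exists_pushout (h : E.IsConflation i p) {A' : C} (f : A ⟶ A') :
    ∃ (B' : C) (f' : B ⟶ B') (i' : A' ⟶ B') (p' : B' ⟶ Z), IsPushout i f f' i' ∧
      E.IsConflation i' p' ∧ f' ≫ p' = p := by
  obtain ⟨B', f', i', sq, -⟩ := E.inflation_pushout i f ⟨Z, p, h⟩
  have h₁ := sq.inr_desc p (0 : A' ⟶ Z) (by rw [h.zero, comp_zero])
  have h₂ := sq.inl_desc p (0 : A' ⟶ Z) (by rw [h.zero, comp_zero])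
  exact ⟨B', f', i', _, sq, h.of_isPushout sq h₁ h₂, h₂⟩

/-- The pullback of a conflation is a conflation with the same kernel. -/
lemma of_isPullback (h : E.IsConflation i p) {B' Z' : C} {f : Z' ⟶ Z} {f' : B' ⟶ B}
    {p' : B' ⟶ Z'} (sq : IsPullback f' p' p f) {i' : A ⟶ B'} (h₁ : i' ≫ p' = 0)
    (h₂ : i' ≫ f' = i) : E.IsConflation i' p' := by
  obtain ⟨B₁, f₁, p₁, sq₁, A₁, i₁, h'⟩ := E.deflation_pullback p f ⟨A, i, h⟩
  obtain ⟨e, he₁, he₂⟩ : ∃ e : B₁ ≅ B', e.hom ≫ f' = f₁ ∧ e.hom ≫ p' = p₁ :=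
    ⟨sq₁.isoIsPullback _ _ sq, by simp, by simp⟩
  have h'' : E.IsConflation (i₁ ≫ e.hom) p' :=
    of_iso h' (Iso.refl _) e (Iso.refl _) (by simp) (by simp [he₂])
  have := h.mono
  have : Mono i' := mono_of_mono_fac h₂
  refine h''.of_kernel h₁ ?_
  obtain ⟨l, hl⟩ := h.exists_lift (i₁ ≫ e.hom ≫ f') (by
    rw [Category.assoc, Category.assoc, sq.w]
    simpa using h''.zero =≫ f)
  refine ⟨l, sq.hom_ext ?_ ?_⟩
  · rw [Category.assoc, Category.assoc, h₂, hl]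
  · rw [Category.assoc, h₁, h''.zero, comp_zero]

/-- Pullbacks of conflations along arbitrary maps exist. -/
lemma exists_pullback (h : E.IsConflation i p) {Z' : C} (f : Z' ⟶ Z) :
    ∃ (B' : C) (f' : B' ⟶ B) (p' : B' ⟶ Z') (i' : A ⟶ B'), IsPullback f' p' p f ∧
      E.IsConflation i' p' ∧ i' ≫ f' = i := by
  obtain ⟨B', f', p', sq, -⟩ := E.deflation_pullback p f ⟨A, i, h⟩
  have h₁ := sq.lift_fst i (0 : A ⟶ Z') (by rw [h.zero, zero_comp])
  have h₂ := sq.lift_snd i (0 : A ⟶ Z') (by rw [h.zero, zero_comp])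
  exact ⟨B', f', p', _, sq, h.of_isPullback sq h₂ h₁, h₁⟩

/-- A map of conflations which is the identity on the outer terms is an isomorphism. -/
lemma isIso (h : E.IsConflation i p) {B' : C} {i' : A ⟶ B'} {p' : B' ⟶ Z}
    (h' : E.IsConflation i' p') (d : B' ⟶ B) (h₁ : i' ≫ d = i) (h₂ : d ≫ p = p') : IsIso d := by
  have := h.epi
  have := h'.epi
  -- Q is an extension of Z by B'. The map d yields a section k of it, and the resulting projection
  -- of Q onto B' turns r into a retraction m of d. With d also epi, this gives the isomorphism.
  obtain ⟨Q, r, s, q, sq, hc, hq⟩ := h.exists_pushout i'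
  have := hc.mono
  obtain ⟨k, hk⟩ := E.exists_desc h' (d ≫ r - s) (by
    rw [Preadditive.comp_sub, reassoc_of% h₁, sq.w, sub_self])
  have hkq : k ≫ q = 𝟙 _ := by
    rw [← cancel_epi p', reassoc_of% hk, Preadditive.sub_comp, Category.assoc, hq, h₂,
      hc.zero, sub_zero, Category.comp_id]
  obtain ⟨m, hm⟩ := hc.exists_lift (r - p ≫ k) (by
    rw [Preadditive.sub_comp, hq, Category.assoc, hkq, Category.comp_id, sub_self])
  have hd : d ≫ m = 𝟙 _ := by
    rw [← cancel_mono s, Category.assoc, hm, Preadditive.comp_sub, reassoc_of% h₂, hk]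
    simp
  have : Epi d := Preadditive.epi_of_cancel_zero d fun x hx => by
    obtain ⟨y, hy⟩ := E.exists_desc h x (by rw [← h₁, Category.assoc, hx, comp_zero])
    have : y = 0 := by rw [← cancel_epi p', ← h₂, Category.assoc, hy, hx, comp_zero]
    rw [← hy, this, comp_zero]
  have : IsSplitMono d := ⟨⟨m, hd⟩⟩
  exact isIso_of_epi_of_isSplitMono d

/-- A map of conflations which is the identity on the cokernels is a pushout square. -/
lemma isPushout {A' B' : C} {i' : A' ⟶ B'} {p' : B' ⟶ Z} (h' : E.IsConflation i' p')
    (h : E.IsConflation i p) {a : A' ⟶ A} {b : B' ⟶ B} (h₁ : i' ≫ b = a ≫ i)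
    (h₂ : b ≫ p = p') : IsPushout i' a b i := by
  obtain ⟨B₁, b₁, i₁, p₁, sq, hc, hp⟩ := h'.exists_pushout a
  have e₁ := sq.inl_desc b i h₁
  have e₂ := sq.inr_desc b i h₁
  generalize sq.desc b i h₁ = d at e₁ e₂
  have : IsIso d := h.isIso hc d e₂ (sq.hom_ext (by rw [reassoc_of% e₁, h₂, hp])
    (by rw [reassoc_of% e₂, h.zero, hc.zero]))
  exact sq.of_iso (Iso.refl _) (Iso.refl _) (Iso.refl _) (asIso d) (by simp) (by simp)
    (by simpa using e₁) (by simpa using e₂)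

/-- The pullback of an inflation along a deflation is an inflation with the same cokernel. -/
lemma of_isPullback_deflation (h : E.IsConflation i p) {A' B' : C} {q : B' ⟶ B} {a : A' ⟶ A}
    {i' : A' ⟶ B'} (hq : E.deflations q) (sq : IsPullback a i' i q) :
    E.IsConflation i' (q ≫ p) := by
  have hw := h.zero
  obtain ⟨K, k, hk⟩ := hq
  have := h.mono
  obtain ⟨K', k', w, hc⟩ := E.deflation_comp q p ⟨K, k, hk⟩ ⟨A, i, h⟩
  have hc : E.IsConflation k' (q ≫ p) := ⟨w, hc⟩
  have : Mono i' := ⟨fun x y hxy => sq.hom_ext (by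
    rw [← cancel_mono i, Category.assoc, Category.assoc, sq.w, reassoc_of% hxy]) hxy⟩
  refine hc.of_kernel (by rw [← reassoc_of% sq.w, hw, comp_zero]) ?_
  obtain ⟨l, hl⟩ := h.exists_lift (k' ≫ q) (by rw [Category.assoc, hc.zero])
  exact ⟨sq.lift l k' hl, by simp⟩

/-- Pulling back a deflation along the maps of a colimit cocone gives a colimit cocone. -/
lemma nonempty_isColimit {J : Type*} [Category J] [IsConnected J] {F G : J ⥤ C}
    {c : Cocone F} (hc : IsColimit c) {c' : Cocone G} {i : A ⟶ c'.pt} {p : c'.pt ⟶ c.pt}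
    (h : E.IsConflation i p) (π : G ⟶ F) (k : (Functor.const J).obj A ⟶ G)
    (hk : ∀ j, E.IsConflation (k.app j) (π.app j)) (hi : ∀ j, k.app j ≫ c'.ι.app j = i)
    (hp : ∀ j, c'.ι.app j ≫ p = π.app j ≫ c.ι.app j) : Nonempty (IsColimit c') := by
  have hJ : Nonempty J := inferInstance
  obtain ⟨j₀⟩ := hJ
  -- Uniqueness: x vanishes on A, so it descends to `c.pt`, where it is tested on the legs of the
  -- colimit.
  have hepi {T : C} (x : c'.pt ⟶ T) (hx : ∀ j, c'.ι.app j ≫ x = 0) : x = 0 := by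
    obtain ⟨y, rfl⟩ := E.exists_desc h x (by rw [← hi j₀, Category.assoc, hx, comp_zero])
    have : y = 0 := hc.hom_ext fun j => by
      have := (hk j).epi
      rw [← cancel_epi (π.app j), ← reassoc_of% (hp j), hx, comp_zero, comp_zero]
    rw [this, comp_zero]
  have hdesc (s : Cocone G) : ∃ x : c'.pt ⟶ s.pt, ∀ j, c'.ι.app j ≫ x = s.ι.app j := by
    -- Connectedness of J makes all legs of s restrict to a single map A → `s.pt`.
    have hs (j : J) : k.app j ≫ s.ι.app j = k.app j₀ ≫ s.ι.app j₀ :=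
      constant_of_preserves_morphisms (fun j => k.app j ≫ s.ι.app j) (fun j₁ j₂ f => by
        have := k.naturality f
        simp only [Functor.const_obj_obj, Functor.const_obj_map, Category.id_comp] at this
        rw [this, Category.assoc, s.w]) j j₀
    -- Colimits need not be exact, so the descent goes through the pushout extension Q of `c.pt` by
    -- `s.pt`. The two ways of mapping `G.obj j` to Q agree on A, so their difference descends to
    -- `F.obj j`. These differences assemble to a section of q, and r corrected by it lands in
    -- `s.pt`.
    obtain ⟨Q, r, t, q, sq, hq, hrq⟩ := h.exists_pushout (k.app j₀ ≫ s.ι.app j₀)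
    have := hq.mono
    have hl (j : J) : ∃ l : F.obj j ⟶ Q, π.app j ≫ l = c'.ι.app j ≫ r - s.ι.app j ≫ t :=
      E.exists_desc (hk j) _ (by
        rw [Preadditive.comp_sub, reassoc_of% (hi j), sq.w, reassoc_of% (hs j), Category.assoc,
          sub_self])
    choose l hl using hl
    let d : Cocone F :=
      { pt := Q
        ι :=
          { app := l
            naturality := fun j₁ j₂ f => by
              have := (hk j₁).epi
              have hG := π.naturality f
              dsimp
              rw [Category.comp_id, ← cancel_epi (π.app j₁), hl, ← reassoc_of% hG, hl]
              simp } }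
    have hd (j : J) : c.ι.app j ≫ hc.desc d = l j := hc.fac d j
    obtain ⟨x, hx⟩ := hq.exists_lift (r - p ≫ hc.desc d) (by
      rw [Preadditive.sub_comp, hrq, sub_eq_zero, Category.assoc]
      have : hc.desc d ≫ q = 𝟙 _ := hc.hom_ext fun j => by
        have := (hk j).epi
        rw [reassoc_of% (hd j), ← cancel_epi (π.app j), reassoc_of% (hl j)]
        simp [hrq, hq.zero, hp]
      rw [this, Category.comp_id])
    refine ⟨x, fun j => ?_⟩
    rw [← cancel_mono t, Category.assoc, hx, Preadditive.comp_sub, reassoc_of% (hp j), hd, hl]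
    abel
  choose f hf using hdesc
  exact ⟨
    { desc := f
      fac := hf
      uniq := fun s m hm => sub_eq_zero.1 (hepi _ fun j => by
        rw [Preadditive.comp_sub, hm, hf, sub_self]) }⟩

/-- The pullbacks of a conflation along the maps of a cocone form a functor. -/
lemma exists_pullbackFunctor {J : Type*} [Category J] {F : J ⥤ C} (c : Cocone F)
    {i : A ⟶ B} {p : B ⟶ c.pt} (h : E.IsConflation i p) :
    ∃ (G : J ⥤ C) (π : G ⟶ F) (β : G ⟶ (Functor.const J).obj B)
      (k : (Functor.const J).obj A ⟶ G), ∀ j, IsPullback (β.app j) (π.app j) p (c.ι.app j) ∧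
        E.IsConflation (k.app j) (π.app j) ∧ k.app j ≫ β.app j = i := by
  choose G β π k sq hk hi using fun j => h.exists_pullback (c.ι.app j)
  have w {j₁ j₂ : J} (f : j₁ ⟶ j₂) : β j₁ ≫ p = (π j₁ ≫ F.map f) ≫ c.ι.app j₂ := by
    rw [Category.assoc, c.w, (sq j₁).w]
  refine ⟨{ obj := G, map := fun f => (sq _).lift _ _ (w f), map_id := ?_, map_comp := ?_ },
    { app := π, naturality := ?_ }, { app := β, naturality := ?_ },
    { app := k, naturality := ?_ }, fun j => ⟨sq j, hk j, hi j⟩⟩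
  · exact fun j => (sq j).hom_ext (by simp) (by simp)
  · exact fun f g => (sq _).hom_ext (by simp) (by simp)
  · intro j₁ j₂ f; simp
  · intro j₁ j₂ f; simp
  · intro j₁ j₂ f
    exact (sq _).hom_ext (by simp [hi]) (by simp [(hk _).zero, reassoc_of% (hk j₁).zero])

end IsConflation

end Conflations

/-! ### Filtered objects and lifting properties. -/

section Filtrations

variable {C : Type u} [Category.{v} C] [Preadditive C] [HasZeroObject C] [HasBinaryBiproducts C]
  {E : ExactStructure C}

/-- An inflation with an `S`-filtered cokernel is a transfinite composition of inflations with
cokernels in `S`. -/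
lemma IsConflation.transfiniteCompositions {S : ObjectProperty C} {A B Z : C} {i : A ⟶ B}
    {p : B ⟶ Z} (h : E.IsConflation i p) (hZ : E.filt S Z) :
    (E.inflationsWithCokernelIn S).transfiniteCompositions.{v} i := by
  obtain ⟨J, _, _, _, _, ⟨t⟩⟩ := (MorphismProperty.transfiniteCompositions_iff _ _).1 hZ
  -- Pulling the filtration of Z back along p gives a filtration of B that starts at A.
  obtain ⟨G, π, β, k, H⟩ := h.exists_pullbackFunctor (Cocone.mk Z t.incl)
  rw [MorphismProperty.transfiniteCompositions_iff]
  refine ⟨J, inferInstance, inferInstance, inferInstance, inferInstance, ?_⟩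
  have hsq {j₁ j₂ : J} (f : j₁ ⟶ j₂) :
      IsPullback (π.app j₁) (G.map f) (t.F.map f) (π.app j₂) := by
    refine IsPullback.flip (IsPullback.of_right (h₁₂ := β.app j₂) (h₂₂ := t.incl.app j₂) (v₁₃ := p)
      ?_ (π.naturality f) (H j₂).1)
    simpa using (H j₁).1
  -- The bottom stage of the filtration of Z is zero, so the pullback there is the kernel A.
  obtain ⟨l, hl⟩ := (H ⊥).2.1.exists_lift (𝟙 _)
    ((IsZero.of_iso (isZero_zero C) t.isoBot).eq_of_tgt _ _)
  have := (H ⊥).2.1.mono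
  exact ⟨
    { F := G
      isoBot := ⟨l, k.app ⊥, hl, by
        rw [← cancel_mono (k.app ⊥), Category.assoc, hl, Category.comp_id, Category.id_comp]⟩
      isWellOrderContinuous := ⟨fun m hm => by
        have : Nonempty (Set.Iio m) := ⟨⟨⊥, hm.bot_lt⟩⟩
        have := IsFiltered.isConnected (Set.Iio m)
        refine IsConflation.nonempty_isColimit (t.F.isColimitOfIsWellOrderContinuous m hm)
          (H m).2.1 (Functor.whiskerLeft _ π) (Functor.whiskerLeft _ k)
          (fun j => (H j.1).2.1) (fun j => ?_) (fun j => π.naturality _)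
        have hj : k.app j.1 ≫ G.map (homOfLE j.2.le) = k.app m := by
          simpa using (k.naturality (homOfLE j.2.le)).symm
        exact hj⟩
      incl := β
      isColimit := by
        have := IsFiltered.isConnected J
        exact (IsConflation.nonempty_isColimit t.isColimit h π k (fun j => (H j).2.1)
          (fun j => (H j).2.2) (fun j => (H j).1.w)).some
      fac := (H ⊥).2.2
      map_mem := fun j hj => by
        obtain ⟨T, q, hq, hT⟩ := t.map_mem j hj
        -- Each step upstairs is the pullback of a step downstairs along a deflation, hence has the
        -- same cokernel.
        exact ⟨T, _, hq.of_isPullback_deflation ⟨_, _, (H _).2.1⟩ (hsq _), hT⟩ }⟩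

/-- A map with the right lifting property with respect to the inflations with cokernels in `S` also
has it with respect to the inflations with `S`-filtered cokernels. -/
lemma IsConflation.hasLiftingProperty {S : ObjectProperty C} {A B Z : C} {i : A ⟶ B}
    {p : B ⟶ Z} (h : E.IsConflation i p) (hZ : E.filt S Z) {X Y : C} {f : X ⟶ Y}
    (hf : (E.inflationsWithCokernelIn S).rlp f) : HasLiftingProperty i f := by
  have hle : E.inflationsWithCokernelIn S ≤ (E.inflationsWithCokernelIn S).rlp.llp :=
    MorphismProperty.le_llp_rlp _
  exact MorphismProperty.transfiniteCompositions_le _ _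
    (MorphismProperty.transfiniteCompositions_monotone hle _ (h.transfiniteCompositions hZ)) f hf

/-- Lifting against a strongly homological class of inflations. -/
lemma IsStronglyHomological.rlp_le {S : ObjectProperty C} {I : MorphismProperty C}
    (hI : E.IsStronglyHomological I) (hS : E.coker I = S.isoClosure) :
    I.rlp ≤ (E.inflationsWithCokernelIn S).rlp := by
  rintro X Y f hf A B i ⟨Z, p, hc, hZ⟩
  obtain ⟨A', B', i', p', a, b, hi', hc', h₁, h₂⟩ :=
    hI i p hc (hS ▸ S.le_isoClosure _ hZ)
  have := hf i' hi'
  -- A map of conflations over the identity of Z exhibits i as a pushout of i', and left lifting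
  -- properties pass to pushouts.
  exact (hc'.isPushout hc h₁ h₂).flip.hasLiftingProperty f

end Filtrations

end ExactStructure

/-! ### Transfinite iteration over all ordinals in a category with few colimits. -/

section TransfiniteIteration

universe w

variable {A : Type*} [Category A] {D : Type*} [Category D]

lemma CategoryTheory.MorphismProperty.of_map_of_fullyFaithful (h : A ⥤ D) [h.Full] [h.Faithful]
    (W : MorphismProperty A) [W.RespectsIso] {X Y : A} {f : X ⟶ Y} (hf : W.map h (h.map f)) :
    W f := by
  obtain ⟨X', Y', f', hf', ⟨e⟩⟩ := hf
  let e₁ : h.obj X' ≅ h.obj X := Arrow.leftFunc.mapIso e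
  let e₂ : h.obj Y' ≅ h.obj Y := Arrow.rightFunc.mapIso e
  refine (W.arrow_mk_iso_iff (Arrow.isoMk' f' f (h.preimageIso e₁) (h.preimageIso e₂)
    (h.map_injective ?_))).1 hf'
  rw [h.map_comp, h.map_comp, h.preimageIso_hom, h.preimageIso_hom, h.map_preimage, h.map_preimage]
  exact e.hom.w

lemma CategoryTheory.Functor.IsWellOrderContinuous.of_comp {J : Type*} [PartialOrder J]
    (F : J ⥤ A) (h : A ⥤ D) [h.Full] [h.Faithful] [(F ⋙ h).IsWellOrderContinuous] :
    F.IsWellOrderContinuous where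
  nonempty_isColimit m hm :=
    ⟨isColimitOfReflects h ((F ⋙ h).isColimitOfIsWellOrderContinuous m hm)⟩

/-- An ordinal `o` as a principal segment of the ordinals. -/
noncomputable def Ordinal.toTypePrincipalSeg (o : Ordinal.{w}) : o.ToType <i Ordinal.{w} :=
  PrincipalSeg.relIsoTrans (Ordinal.ToType.mk (o := o)).symm.toRelIsoLT (Set.principalSegIio o)

lemma Ordinal.noMaxOrder_toType {o : Ordinal.{w}} (ho : Order.IsSuccLimit o) :
    NoMaxOrder o.ToType :=
  Ordinal.isSuccPrelimit_type_lt_iff.1 (by rw [Ordinal.type_toType]; exact ho.isSuccPrelimit)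

lemma Ordinal.nonempty_toType {o : Ordinal.{w}} (ho : Order.IsSuccLimit o) : Nonempty o.ToType :=
  ⟨Ordinal.ToType.mk ⟨⊥, ho.bot_lt⟩⟩

instance (o : Ordinal.{w}) (F : Ordinal.{w} ⥤ A) [F.IsWellOrderContinuous] :
    (o.toTypePrincipalSeg.monotone.functor ⋙ F).IsWellOrderContinuous :=
  inferInstanceAs ((o.toTypePrincipalSeg :
    o.ToType ≤i Ordinal.{w}).monotone.functor ⋙ F).IsWellOrderContinuous

lemma CategoryTheory.MorphismProperty.principalSeg_map_mem (W : MorphismProperty A)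
    {J K : Type*} [LinearOrder J] [SuccOrder J] [NoMaxOrder J] [LinearOrder K] [SuccOrder K]
    (f : J <i K) (F : K ⥤ A) (j : J) (hF : W (F.map (homOfLE (Order.le_succ (f j))))) :
    W ((f.monotone.functor ⋙ F).map (homOfLE (Order.le_succ j))) := by
  have key (k : K) (hk : k = Order.succ (f j)) (φ : f j ⟶ k) : W (F.map φ) := by
    subst hk
    exact hF
  exact key _ (f.map_succ j) _

/-- Transfinite iteration: if every object `X` is the source of a map in `W`, and the sequences of
maps in `W` have colimits, then there are sequences of maps in `W` indexed by all ordinals. -/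
theorem CategoryTheory.MorphismProperty.exists_transfiniteIteration (W : MorphismProperty A)
    [W.RespectsIso] (X₀ : A) (hW : ∀ X, ∃ (Y : A) (f : X ⟶ Y), W f)
    (hcolim : ∀ (J : Type w) [LinearOrder J] [SuccOrder J] [OrderBot J] [WellFoundedLT J]
      (F : J ⥤ A) [F.IsWellOrderContinuous],
      (∀ j : J, ¬ IsMax j → W (F.map (homOfLE (Order.le_succ j)))) → HasColimit F) :
    ∃ F : Ordinal.{w} ⥤ A, F.IsWellOrderContinuous ∧ Nonempty (F.obj ⊥ ≅ X₀) ∧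
      ∀ o, W (F.map (homOfLE (Order.le_succ o))) := by
  -- The iteration is run in a category with enough colimits, into which A embeds fully faithfully
  -- by a functor that preserves colimits. The lift to `w + 1` accommodates diagrams indexed by
  -- `Ordinal.{w}`.
  let h := (uliftCoyoneda.{w + 1} (C := A)).rightOp
  have : PreservesColimitsOfSize.{w, w} h :=
    preservesColimitsOfSize_rightOp (uliftCoyoneda.{w + 1} (C := A))
  -- The successor must be defined on every object; outside the essential image it is an irrelevant
  -- identity.
  have hstep (X : (A ⥤ Type _)ᵒᵖ) : ∃ (Y : (A ⥤ Type _)ᵒᵖ) (t : X ⟶ Y),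
      h.essImage X → h.essImage Y ∧ W.map h t := by
    by_cases hX : h.essImage X
    · obtain ⟨x, ⟨e⟩⟩ := hX
      obtain ⟨y, f, hf⟩ := hW x
      exact ⟨h.obj y, e.inv ≫ h.map f, fun _ => ⟨h.obj_mem_essImage y,
        ((W.map h).cancel_left_of_respectsIso _ _).2 (W.map_mem_map h f hf)⟩⟩
    · exact ⟨X, 𝟙 X, fun hX' => (hX hX').elim⟩
  choose s t hst using hstep
  let Φ : SmallObject.SuccStruct (A ⥤ Type _)ᵒᵖ := ⟨h.obj X₀, s, t⟩
  let G := Φ.iterationFunctor Ordinal.{w}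
  have hG₀ (o : Ordinal.{w}) (ho : h.essImage (G.obj o)) :
      h.essImage (G.obj (Order.succ o)) ∧ W.map h (G.map (homOfLE (Order.le_succ o))) := by
    have hs := Φ.iterationFunctor_map_succ o (not_isMax o)
    obtain ⟨h₁, h₂⟩ := hst _ ho
    exact ⟨h₁.ofIso (Φ.iterationFunctorObjSuccIso o (not_isMax o)).symm, by
      change W.map h ((Φ.iterationFunctor _).map _)
      rw [hs]
      exact ((W.map h).cancel_right_of_respectsIso _ _).2 h₂⟩
  have hG (o : Ordinal.{w}) : h.essImage (G.obj o) := by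
    induction o using SuccOrder.limitRecOn with
    | isMin o ho =>
      obtain rfl := ho.eq_bot
      exact ⟨X₀, ⟨(Φ.iterationFunctorObjBotIso _).symm⟩⟩
    | succ o _ ho => exact (hG₀ o ho).1
    | isSuccLimit o hlim ho =>
      -- At a limit, the segment below o lifts to A by induction. Its colimit exists there by
      -- `hcolim`, and h carries it to the stage o.
      let f := o.toTypePrincipalSeg
      have := Ordinal.nonempty_toType hlim
      let _ : OrderBot o.ToType := WellFoundedLT.toOrderBot _
      let _ : SuccOrder o.ToType := SuccOrder.ofLinearWellFoundedLT _
      have := Ordinal.noMaxOrder_toType hlim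
      have hf (j : o.ToType) : f j < o := f.lt_top j
      let F := f.monotone.functor ⋙ G
      have hF (j : o.ToType) : h.essImage (F.obj j) := ho _ (hf j)
      let F' := Functor.essImage.liftFunctor F h hF
      let e : F' ⋙ h ≅ F := Functor.essImage.liftFunctorCompIso F h hF
      have : (F' ⋙ h).IsWellOrderContinuous := Functor.isWellOrderContinuous_of_iso e.symm
      have := Functor.IsWellOrderContinuous.of_comp F' h
      have := hcolim _ F' fun j _ => W.of_map_of_fullyFaithful h <|
        ((W.map h).arrow_mk_iso_iff (((Functor.mapArrowFunctor _ _).mapIso e).app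
          (CategoryTheory.Arrow.mk (homOfLE (Order.le_succ j))))).2
          ((W.map h).principalSeg_map_mem f G j (hG₀ _ (ho _ (hf j))).2)
      exact ⟨colimit F', ⟨(isColimitOfPreserves h (colimit.isColimit F')).coconePointsIsoOfNatIso
        (G.isColimitOfIsWellOrderContinuous' f hlim) e⟩⟩
  let F := Functor.essImage.liftFunctor G h hG
  let e : F ⋙ h ≅ G := Functor.essImage.liftFunctorCompIso G h hG
  have : (F ⋙ h).IsWellOrderContinuous := Functor.isWellOrderContinuous_of_iso e.symm
  exact ⟨F, Functor.IsWellOrderContinuous.of_comp F h,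
    ⟨h.preimageIso (e.app ⊥ ≪≫ Φ.iterationFunctorObjBotIso _)⟩,
    fun o => W.of_map_of_fullyFaithful h <|
        ((W.map h).arrow_mk_iso_iff (((Functor.mapArrowFunctor _ _).mapIso e).app
          (CategoryTheory.Arrow.mk (homOfLE (Order.le_succ o))))).2 (hG₀ _ (hG o)).2⟩

end TransfiniteIteration

/-! ### The small object argument, one extension at a time. -/

section SmallObjectArgument

universe w

/-- A normal function H is built by recursion so that H o exceeds h b for every b ≤ H a with a < o.
Its values at limit ordinals are then closed under h. Normal functions preserve the cofinality of
limit ordinals, so evaluating at the initial ordinal of a regular cardinal above κ suffices. -/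
lemma Ordinal.exists_isSuccLimit_closed (h : Ordinal.{w} → Ordinal.{w}) (κ : Cardinal.{w}) :
    ∃ δ : Ordinal.{w}, Order.IsSuccLimit δ ∧ κ ≤ δ.cof ∧ ∀ γ < δ, h γ < δ := by
  let c : Cardinal.{w} := Order.succ (max κ Cardinal.aleph0)
  have hc : c.IsRegular := Cardinal.isRegular_succ (le_max_right _ _)
  have hcl : Order.IsSuccLimit c.ord := Cardinal.isSuccLimit_ord hc.aleph0_le
  let H : Ordinal.{w} → Ordinal.{w} := WellFoundedLT.fix fun o G =>
    ⨆ a : Set.Iio o, Order.succ (⨆ b : Set.Iic (G a.1 a.2), Order.succ (h b.1) ⊔ b.1)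
  have hH (o : Ordinal.{w}) : H o =
      ⨆ a : Set.Iio o, Order.succ (⨆ b : Set.Iic (H a.1), Order.succ (h b.1) ⊔ b.1) :=
    WellFoundedLT.fix_eq _ _
  have hlt {a o : Ordinal.{w}} (ha : a < o) {b : Ordinal.{w}} (hb : b ≤ H a) :
      h b < H o ∧ b < H o := by
    have h₁ : Order.succ (h b) ⊔ b ≤ ⨆ b : Set.Iic (H a), Order.succ (h b.1) ⊔ b.1 :=
      Ordinal.le_iSup (fun b : Set.Iic (H a) => Order.succ (h b.1) ⊔ b.1) ⟨b, hb⟩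
    have h₂ : Order.succ (⨆ b : Set.Iic (H a), Order.succ (h b.1) ⊔ b.1) ≤ H o := by
      rw [hH o]
      exact Ordinal.le_iSup (fun a : Set.Iio o =>
        Order.succ (⨆ b : Set.Iic (H a.1), Order.succ (h b.1) ⊔ b.1)) ⟨a, ha⟩
    have h₃ := (Order.lt_succ _).trans_le h₂
    exact ⟨((Order.lt_succ _).trans_le (le_sup_left.trans h₁)).trans h₃,
      (le_sup_right.trans h₁).trans_lt h₃⟩
  have hmono : StrictMono H := fun a o ha => (hlt ha le_rfl).2
  have hsup {o : Ordinal.{w}} (ho : Order.IsSuccLimit o) {b : Ordinal.{w}} (hb : b < H o) :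
      ∃ a < o, b < H a := by
    rw [hH o, Ordinal.lt_iSup_iff] at hb
    obtain ⟨⟨a, ha⟩, hb⟩ := hb
    refine ⟨Order.succ a, ho.succ_lt ha, (Order.lt_succ_iff.1 hb).trans_lt ?_⟩
    refine lt_of_le_of_lt (b := ⨆ b : Set.Iic (H a), Order.succ (h b.1) ⊔ b.1) le_rfl ?_
    rw [hH (Order.succ a)]
    exact (Order.lt_succ _).trans_le (Ordinal.le_iSup (fun a : Set.Iio _ =>
        Order.succ (⨆ b : Set.Iic (H a.1), Order.succ (h b.1) ⊔ b.1)) ⟨a, Order.lt_succ a⟩)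
  have hnormal : Order.IsNormal H := Order.isNormal_iff.2 ⟨hmono, fun o ho a hle => not_lt.1 fun hlt => by
    obtain ⟨b, hb, hab⟩ := hsup ho hlt
    exact (hle b hb).not_gt hab⟩
  refine ⟨H c.ord, hnormal.map_isSuccLimit hcl, ?_, fun γ hγ => ?_⟩
  · rw [Ordinal.cof_map_of_isNormal hnormal hcl, hc.cof_ord]
    exact (le_max_left _ _).trans (Order.le_succ _)
  · obtain ⟨a, ha, hb⟩ := hsup hcl hγ
    exact (hlt ha hb.le).1

namespace CategoryTheory.MorphismProperty

variable {A : Type*} [Category.{v} A]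

/-- `X` is injective relative to a class `I` of maps. -/
def IsInjectiveObject (I : MorphismProperty A) (X : A) : Prop :=
  ∀ ⦃P Q : A⦄ (i : P ⟶ Q), I i → ∀ a : P ⟶ X, ∃ l : Q ⟶ X, i ≫ l = a

/-- The maps `X ⟶ Y` which adjoin a single missing extension along a map in `I`, or are
isomorphisms, if `X` is already injective relative to `I`. -/
def attachments (I : MorphismProperty A) : MorphismProperty A := fun X _ f =>
  (∃ (P Q : A) (i : P ⟶ Q) (a : P ⟶ X), I i ∧ (¬ ∃ l, i ≫ l = a) ∧ ∃ b, IsPushout i a b f) ∨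
    (I.IsInjectiveObject X ∧ IsIso f)

instance (I : MorphismProperty A) : I.attachments.RespectsIso :=
  .of_respects_arrow_iso _ fun f g e hf => by
    let e₁ : f.left ≅ g.left := Arrow.leftFunc.mapIso e
    let e₂ : f.right ≅ g.right := Arrow.rightFunc.mapIso e
    have he : e₁.hom ≫ g.hom = f.hom ≫ e₂.hom := e.hom.w
    obtain ⟨P, Q, i, a, hi, hl, b, sq⟩ | ⟨h₁, h₂⟩ := hf
    · refine Or.inl ⟨P, Q, i, a ≫ e₁.hom, hi, fun ⟨l, hl'⟩ => hl ⟨l ≫ e₁.inv, ?_⟩,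
        b ≫ e₂.hom, sq.of_iso (Iso.refl _) (Iso.refl _) e₁ e₂ ?_ ?_ ?_ ?_⟩
      · rw [← Category.assoc, hl', Category.assoc, e₁.hom_inv_id, Category.comp_id]
      · simp
      · simp
      · simp
      · exact he.symm
    · refine Or.inr ⟨fun P Q i hi a => ?_, ?_⟩
      · obtain ⟨l, hl⟩ := h₁ i hi (a ≫ e₁.inv)
        exact ⟨l ≫ e₁.hom, by simp [reassoc_of% hl]⟩
      · have : g.hom = e₁.inv ≫ f.hom ≫ e₂.hom := by rw [← he]; simp
        rw [this]
        infer_instance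

/-- The small object argument, adjoining one extension at a time: only colimits of the sequences
that occur are needed. -/
theorem exists_isInjectiveObject (I W : MorphismProperty A) [IsSmall.{v} I]
    (hI : I.pushouts ≤ W) (hW : isomorphisms A ≤ W)
    (hpush : ∀ ⦃P Q X : A⦄ (i : P ⟶ Q) (a : P ⟶ X), I i → HasPushout i a)
    (hcolim : ∀ (J : Type v) [LinearOrder J] [SuccOrder J] [OrderBot J] [WellFoundedLT J]
      (F : J ⥤ A) [F.IsWellOrderContinuous],
      (∀ j : J, ¬ IsMax j → W (F.map (homOfLE (Order.le_succ j)))) → HasColimit F)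
    (hsmall : ∀ ⦃P Q : A⦄ (i : P ⟶ Q), I i → ∃ κ : Cardinal.{v}, ∀ (J : Type v) [LinearOrder J]
      [SuccOrder J] [OrderBot J] [WellFoundedLT J] (F : J ⥤ A) [F.IsWellOrderContinuous],
      κ ≤ Order.cof J → (∀ j : J, ¬ IsMax j → W (F.map (homOfLE (Order.le_succ j)))) →
      ∀ (c : Cocone F), IsColimit c → ∀ a : P ⟶ c.pt, ∃ (j : J) (a' : P ⟶ F.obj j),
        a' ≫ c.ι.app j = a) (X₀ : A) :
    ∃ (X : A) (f : X₀ ⟶ X), transfiniteCompositions.{v} I.pushouts f ∧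
      I.IsInjectiveObject X := by
  have hIW : I.attachments ≤ W := by
    rintro X Y f (⟨P, Q, i, a, hi, -, b, sq⟩ | ⟨-, h⟩)
    · exact hI _ ⟨P, Q, i, a, b, hi, sq.flip⟩
    · exact hW _ h
  obtain ⟨F, _, ⟨e⟩, hF⟩ := I.attachments.exists_transfiniteIteration X₀ (fun X => by
    by_cases hX : I.IsInjectiveObject X
    · exact ⟨X, 𝟙 X, Or.inr ⟨hX, inferInstance⟩⟩
    · simp only [IsInjectiveObject, not_forall] at hX
      obtain ⟨P, Q, i, hi, a, hl⟩ := hX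
      have := hpush i a hi
      exact ⟨_, pushout.inr i a, Or.inl ⟨P, Q, i, a, hi, hl, _, IsPushout.of_hasPushout i a⟩⟩)
    (fun J _ _ _ _ F _ h => hcolim J F fun j hj => hIW _ (h j hj))
  -- If no stage were injective, every ordinal o would solve an extension problem q o that is
  -- unsolvable at stage o.
  have hex : ∃ δ, I.IsInjectiveObject (F.obj δ) := by
    by_contra! hno
    obtain ⟨ι, A₁, A₂, i, rfl⟩ := (isSmall_iff_eq_ofHoms.{v} I).1 inferInstance
    have hq (o : Ordinal.{v}) : ∃ q : Σ k, A₁ k ⟶ F.obj o, (¬ ∃ l, i q.1 ≫ l = q.2) ∧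
        ∃ b, i q.1 ≫ b = q.2 ≫ F.map (homOfLE (Order.le_succ o)) := by
      obtain ⟨P, Q, _, a, ⟨k⟩, hl, b, sq⟩ | ⟨h, -⟩ := hF o
      · exact ⟨⟨k, a⟩, hl, b, sq.w⟩
      · exact (hno o h).elim
    choose q hq₁ hq₂ using hq
    -- The stages at which the image of the problem p is the one being solved. There is at most one,
    -- since a solution persists to all later stages.
    let D (γ : Ordinal.{v}) (p : Σ k, A₁ k ⟶ F.obj γ) : Set Ordinal.{v} :=
      {δ | ∃ h : γ ≤ δ, q δ = ⟨p.1, p.2 ≫ F.map (homOfLE h)⟩}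
    have hD (γ : Ordinal.{v}) (p : Σ k, A₁ k ⟶ F.obj γ) {δ δ' : Ordinal.{v}} (hδ : δ ∈ D γ p)
        (hδ' : δ' ∈ D γ p) : ¬ δ < δ' := fun hlt => by
      obtain ⟨h, hδ⟩ := hδ
      obtain ⟨h', hδ'⟩ := hδ'
      have h₁ := hq₁ δ'
      have h₂ := hq₂ δ
      rw [hδ'] at h₁
      rw [hδ] at h₂
      obtain ⟨b, hb⟩ := h₂
      refine h₁ ⟨b ≫ F.map (homOfLE (Order.succ_le_of_lt hlt)), ?_⟩
      dsimp at hb ⊢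
      rw [reassoc_of% hb, ← F.map_comp, ← F.map_comp]
      rfl
    -- The problems at stage γ form a small family, so this bounds all the stages at which problems
    -- from γ are treated.
    let h (γ : Ordinal.{v}) : Ordinal.{v} := ⨆ p, sSup (D γ p)
    choose κ hκ using fun k => hsmall (i k) ⟨k⟩
    obtain ⟨δ, hδ, hcof, hh⟩ := Ordinal.exists_isSuccLimit_closed h (⨆ k, κ k)
    have := Ordinal.nonempty_toType hδ
    let _ : OrderBot δ.ToType := WellFoundedLT.toOrderBot _
    let _ : SuccOrder δ.ToType := SuccOrder.ofLinearWellFoundedLT _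
    have := Ordinal.noMaxOrder_toType hδ
    let f := δ.toTypePrincipalSeg
    -- Smallness brings the problem treated at δ down to an earlier stage. It is thus treated no
    -- later than h of that stage, which is below δ by closure: a contradiction.
    obtain ⟨j, a', ha'⟩ := hκ (q δ).1 δ.ToType (f.monotone.functor ⋙ F)
      ((le_ciSup (Cardinal.bddAbove_of_small) (q δ).1).trans
        (hcof.trans_eq (Ordinal.cof_toType δ).symm))
      (fun j _ => W.principalSeg_map_mem f F j (hIW _ (hF _)))
      _ (F.isColimitOfIsWellOrderContinuous' f hδ) (q δ).2
    have hj : f j < δ := f.lt_top j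
    have hmem : δ ∈ D (f j) ⟨(q δ).1, a'⟩ := ⟨hj.le, Sigma.ext rfl (heq_of_eq ha'.symm)⟩
    have hsing : D (f j) ⟨(q δ).1, a'⟩ = {δ} := Set.eq_singleton_iff_unique_mem.2 ⟨hmem,
      fun δ' hδ' => le_antisymm (not_lt.1 (hD _ _ hmem hδ')) (not_lt.1 (hD _ _ hδ' hmem))⟩
    have hle : δ ≤ h (f j) := by
      have := Ordinal.le_iSup (fun p => sSup (D (f j) p)) ⟨(q δ).1, a'⟩
      rwa [hsing, csSup_singleton] at this
    exact (hh _ hj).not_ge hle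
  -- Before the first injective stage no step is of the isomorphism kind, so all of them are
  -- pushouts of maps in I.
  let δ := WellFounded.min (wellFounded_lt (α := Ordinal.{v})) {δ | I.IsInjectiveObject (F.obj δ)} hex
  have hδ : I.IsInjectiveObject (F.obj δ) := WellFounded.min_mem wellFounded_lt _ hex
  have hF' (o : Ordinal.{v}) (ho : o < δ) :
      I.pushouts (F.map (homOfLE (Order.le_succ o))) := by
    obtain ⟨P, Q, i, a, hi, -, b, sq⟩ | ⟨h, -⟩ := hF o
    · exact ⟨P, Q, i, a, b, hi, sq.flip⟩
    · exact (WellFounded.not_lt_min wellFounded_lt _ h ho).elim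
  -- Indexing by the closed segment makes the colimit trivial, as there is a top element; it is
  -- afterwards shrunk into `Type v`.
  let t : I.pushouts.TransfiniteCompositionOfShape (Set.Iic δ)
      (e.inv ≫ F.map (homOfLE bot_le : ⊥ ⟶ δ)) :=
    { F := (Set.initialSegIic δ).monotone.functor ⋙ F
      isoBot := e
      incl :=
        { app i := F.map (homOfLE i.2)
          naturality i i' φ := (F.map_comp (homOfLE (leOfHom φ)) (homOfLE i'.2)).symm.trans
            (Category.comp_id _).symm }
      isColimit := colimitOfDiagramTerminal isTerminalTop _
      map_mem := fun i hi => by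
        have hlt : i.1 < δ := by
          obtain ⟨i', hi'⟩ := not_isMax_iff.1 hi
          exact lt_of_lt_of_le hi' i'.2
        have key (k : Ordinal.{v}) (hk : k = Order.succ i.1) (φ : i.1 ⟶ k) :
            I.pushouts (F.map φ) := by
          subst hk
          exact hF' _ hlt
        exact key _ (Set.Iic.coe_succ_of_not_isMax hi) _ }
  refine ⟨F.obj δ, _, transfiniteCompositionsOfShape_le_transfiniteCompositions _ _ _
    (t.ofOrderIso (orderIsoShrink.{v} (Set.Iic δ)).symm).mem, hδ⟩

end CategoryTheory.MorphismProperty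

end SmallObjectArgument

/-! ### Transport of the data to over categories. -/

section OverCategory

variable {C : Type u} [Category.{v} C]

/-- Binary products make the forgetful functor a left adjoint, so it preserves colimits. -/
instance [HasBinaryProducts C] (M : C) (J : Type*) [LinearOrder J] :
    PreservesWellOrderContinuousOfShape J (Over.forget M) where

lemma CategoryTheory.Over.pushouts_inverseImage_forget_le [HasBinaryProducts C]
    (I : MorphismProperty C) (M : C) :
    (I.inverseImage (Over.forget M)).pushouts ≤ I.pushouts.inverseImage (Over.forget M) := by
  rintro X Y f ⟨P, Q, i, a, b, hi, sq⟩
  exact ⟨_, _, _, _, _, hi, sq.map (Over.forget M)⟩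

/-- A map over M is determined by its underlying map and the structure map of its target, and both
range over small families. -/
lemma CategoryTheory.Over.isSmall_inverseImage_forget (I : MorphismProperty C)
    [MorphismProperty.IsSmall.{v} I] (M : C) :
    MorphismProperty.IsSmall.{v} (I.inverseImage (Over.forget M)) := by
  obtain ⟨ι, A, B, i, rfl⟩ := (MorphismProperty.isSmall_iff_eq_ofHoms.{v} I).1 inferInstance
  rw [MorphismProperty.isSmall_iff_eq_ofHoms]
  refine ⟨Σ k, B k ⟶ M, fun x => Over.mk (i x.1 ≫ x.2), fun x => Over.mk x.2,
    fun x => Over.homMk (i x.1), ?_⟩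
  ext X Y f
  constructor
  · intro hf
    have key {P Q : C} (g : P ⟶ Q) (hg : MorphismProperty.ofHoms i g) (x : P ⟶ M) (y : Q ⟶ M)
        (w : g ≫ y = x) : MorphismProperty.ofHoms
          (fun z : Σ k, B k ⟶ M => (Over.homMk (i z.1) : Over.mk (i z.1 ≫ z.2) ⟶ Over.mk z.2))
          (Over.homMk g : Over.mk x ⟶ Over.mk y) := by
      subst w
      obtain ⟨k⟩ := hg
      exact ⟨(⟨k, y⟩ : Σ k, B k ⟶ M)⟩
    exact key f.left hf X.hom Y.hom (Over.w f)
  · rintro ⟨k⟩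
    exact ⟨k.1⟩

end OverCategory

namespace ExactStructure

/-! ### Filtered approximations with the right lifting property. -/

section Precovers

variable {C : Type u} [Category.{v} C] [Preadditive C] [HasZeroObject C] [HasBinaryBiproducts C]
  {E : ExactStructure C}

lemma IsConflation.exists_of_isPushout {A B Z : C} {i : A ⟶ B} {p : B ⟶ Z}
    (h : E.IsConflation i p) {A' B' : C} {f : A ⟶ A'} {f' : B ⟶ B'} {i' : A' ⟶ B'}
    (sq : IsPushout i f f' i') : ∃ p' : B' ⟶ Z, E.IsConflation i' p' :=
  ⟨_, h.of_isPushout sq (sq.inr_desc p 0 (by rw [h.zero, comp_zero])) (sq.inl_desc _ _ _)⟩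

lemma isomorphisms_le_inflations : MorphismProperty.isomorphisms C ≤ E.inflations := by
  intro A B f hf
  have : IsIso f := hf
  obtain ⟨Z, p, h⟩ := E.inflation_id A
  have h : E.IsConflation (𝟙 A) p := h
  exact ⟨Z, _, h.of_iso (p' := inv f ≫ p) (Iso.refl _) (asIso f) (Iso.refl _) (by simp) (by simp)⟩

lemma le_inflationsWithCokernelIn {S : ObjectProperty C} {I : MorphismProperty C}
    (hI : I ≤ E.inflations) (hS : E.coker I = S.isoClosure) :
    I ≤ E.inflationsWithCokernelIn S := by
  intro A B i hi
  obtain ⟨Z, p, h⟩ := hI i hi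
  have hZ : E.coker I Z := ⟨A, B, i, p, hi, h⟩
  rw [hS] at hZ
  obtain ⟨Z', hZ', ⟨e⟩⟩ := hZ
  exact ⟨Z', p ≫ e.hom, h.of_iso (Iso.refl _) (Iso.refl _) e (by simp) (by simp), hZ'⟩

lemma pushouts_inflationsWithCokernelIn_le {S : ObjectProperty C} :
    (E.inflationsWithCokernelIn S).pushouts ≤ E.inflationsWithCokernelIn S := by
  rintro A' B' i' ⟨A, B, i, a, b, ⟨Z, p, h, hZ⟩, sq⟩
  obtain ⟨p', h'⟩ := h.exists_of_isPushout sq.flip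
  exact ⟨Z, p', h', hZ⟩

lemma pushouts_inflations_le : E.inflations.pushouts ≤ E.inflations := by
  rintro A' B' i' ⟨A, B, i, a, b, ⟨Z, p, h⟩, sq⟩
  obtain ⟨p', h'⟩ := h.exists_of_isPushout sq.flip
  exact ⟨Z, p', h'⟩

/-- Every object `M` receives a map from an `S`-filtered object with the right lifting property with
respect to inflations with cokernels in `S`. -/
theorem IsEfficient.exists_filt_rlp (hE : E.IsEfficient) (S : ObjectProperty C)
    [ObjectProperty.Small.{v} S] (M : C) : ∃ (F : C) (f : F ⟶ M), E.filt S F ∧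
      (E.inflationsWithCokernelIn S).rlp f := by
  obtain ⟨I, _, hI, hhom, hS⟩ := hE.exists_stronglyHomological S
  have := Over.isSmall_inverseImage_forget I M
  -- An object over M is injective relative to the maps over M lying in I exactly when its structure
  -- map lifts against I. Starting from 0 → M makes the resulting object filtered.
  obtain ⟨X, f, hf, hX⟩ := MorphismProperty.exists_isInjectiveObject
    (I.inverseImage (Over.forget M)) (E.inflations.inverseImage (Over.forget M))
    ((Over.pushouts_inverseImage_forget_le I M).trans fun X Y f hf =>
      pushouts_inflations_le _ (MorphismProperty.pushouts_monotone hI _ hf))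
    (fun X Y f (_ : IsIso f) => isomorphisms_le_inflations _
      (inferInstanceAs (IsIso ((Over.forget M).map f))))
    (fun P Q X i a hi => by
      obtain ⟨Z, p, h⟩ := hI _ hi
      obtain ⟨_, _, _, _, sq, -⟩ := h.exists_pushout ((Over.forget M).map a)
      have := sq.hasPushout
      have : HasColimit (span i a ⋙ Over.forget M) := hasColimit_of_iso (spanCompIso _ _ _)
      exact hasColimit_of_created (span i a) (Over.forget M))
    (fun J _ _ _ _ F _ h => by
      have := (hE.hasTransfiniteCompositions J (F ⋙ Over.forget M) h).1
      exact hasColimit_of_created F (Over.forget M))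
    (fun P Q i hi => by
      obtain ⟨κ, -, hκ⟩ := hE.hasSmallObjects P.left
      refine ⟨κ, fun J _ _ _ _ F _ hJ h c hc a => ?_⟩
      have hc' := isColimitOfPreserves (Over.forget M) hc
      have : HasColimit (F ⋙ Over.forget M) := ⟨_, hc'⟩
      have := hκ J (F ⋙ Over.forget M) hJ h inferInstance
      obtain ⟨j, a', ha'⟩ := Types.jointly_surjective_of_isColimit
        (isColimitOfPreserves (coyoneda.obj (Opposite.op P.left)) hc') a.left
      have ha' : a' ≫ (c.ι.app j).left = a.left := ha'
      exact ⟨j, Over.homMk a' ((congrArg (a' ≫ ·) (Over.w (c.ι.app j))).symm.trans (by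
        rw [← Over.w a, ← ha']; exact (Category.assoc _ _ _).symm)),
        Over.OverMorphism.ext ha'⟩)
    (Over.mk (0 : (0 : C) ⟶ M))
  refine ⟨X.left, X.hom, ?_, hhom.rlp_le hS _ fun P Q i hi => ⟨fun {a b} sq => ?_⟩⟩
  · obtain ⟨J, _, _, _, _, ⟨t⟩⟩ := (MorphismProperty.transfiniteCompositions_iff _ _).1 hf
    have ht : (E.inflationsWithCokernelIn S).transfiniteCompositions.{v} f.left :=
      (MorphismProperty.transfiniteCompositions_iff _ _).2
        ⟨J, inferInstance, inferInstance, inferInstance, inferInstance,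
          ⟨(t.ofLE ((Over.pushouts_inverseImage_forget_le I M).trans fun X Y f hf =>
            pushouts_inflationsWithCokernelIn_le _ (MorphismProperty.pushouts_monotone
              (le_inflationsWithCokernelIn hI hS) _ hf))).map (W := E.inflationsWithCokernelIn S) (F := Over.forget M)⟩⟩
    have hf₀ : f.left = 0 := (isZero_zero C).eq_of_src _ _
    rwa [hf₀] at ht
  · obtain ⟨l, hl⟩ := hX (Over.homMk i : Over.mk (i ≫ b) ⟶ Over.mk b) hi
      (Over.homMk a (by simpa using sq.w))
    exact ⟨⟨l.left, congrArg CommaMorphism.left hl, by simp⟩⟩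

end Precovers

/-! ### The stable category: the suspension is an equivalence, and vanishing of maps into cones. -/

section StableCategory

variable {C : Type u} [Category.{v} C] [Preadditive C] [HasZeroObject C] [HasBinaryBiproducts C]
  (E : ExactStructure C)

instance : E.toStable.Additive :=
  CategoryTheory.Quotient.functor_additive E.stableRel (fun _ _ _ _ _ _ => E.stableRel_add _ _ _ _)

lemma toStable_map_eq_iff {X Y : C} (f g : X ⟶ Y) :
    E.toStable.map f = E.toStable.map g ↔ E.stableRel f g :=
  CategoryTheory.Quotient.functor_map_eq_iff _ _ _

lemma toStable_map_eq_zero_iff {X Y : C} (f : X ⟶ Y) :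
    E.toStable.map f = 0 ↔ ∃ (P : C) (a : X ⟶ P) (b : P ⟶ Y), E.IsProjective P ∧ f = a ≫ b := by
  rw [← E.toStable.map_zero X Y, toStable_map_eq_iff]
  simp only [stableRel, sub_zero]

lemma toStable_map_eq_zero {X Y P : C} (hP : E.IsProjective P) (a : X ⟶ P) (b : P ⟶ Y) :
    E.toStable.map (a ≫ b) = 0 :=
  (E.toStable_map_eq_zero_iff _).2 ⟨P, a, b, hP, rfl⟩

/-- A map to the target of a deflation which is stably zero lifts along it through a projective. -/
lemma exists_lift_of_toStable_map_eq_zero {X Y Z : C} {f : X ⟶ Z} (hf : E.toStable.map f = 0)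
    {p : Y ⟶ Z} (hp : E.deflations p) : ∃ g : X ⟶ Y, g ≫ p = f := by
  obtain ⟨P, a, b, hP, rfl⟩ := (E.toStable_map_eq_zero_iff f).1 hf
  obtain ⟨b', rfl⟩ := IsProjective.lift E hP p hp b
  exact ⟨a ≫ b', Category.assoc _ _ _⟩

variable [E.IsFrobenius]

variable {E} in
lemma IsInjective.isProjective {I : C} (hI : E.IsInjective I) : E.IsProjective I :=
  (IsFrobenius.injective_iff_projective (E := E) I).1 hI

variable {E} in
lemma IsProjective.isInjective {I : C} (hI : E.IsProjective I) : E.IsInjective I :=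
  (IsFrobenius.injective_iff_projective (E := E) I).2 hI

lemma isProjective_inj (X : C) : E.IsProjective (E.inj X) :=
  IsInjective.isProjective (E.isInjective_inj X)

/-- An endomorphism of a conflation with injective middle term which is the identity on the first
term is stably the identity on the last one. -/
lemma IsConflation.toStable_map_eq_id {X I Z : C} {i : X ⟶ I} {p : I ⟶ Z}
    (h : E.IsConflation i p) (hI : E.IsInjective I) {a : I ⟶ I} {b : Z ⟶ Z} (ha : i ≫ a = i)
    (hb : p ≫ b = a ≫ p) : E.toStable.map b = 𝟙 _ := by
  obtain ⟨d, hd⟩ := E.exists_desc h (a - 𝟙 I) (by simp [ha])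
  have := h.epi
  have hbd : b - 𝟙 Z = d ≫ p := by
    rw [← cancel_epi p, reassoc_of% hd]
    simp [hb]
  rw [← E.toStable.map_id, toStable_map_eq_iff]
  exact ⟨I, d, p, hI.isProjective, hbd⟩

/-- Cosyzygies are unique up to stable isomorphism. -/
lemma nonempty_iso_of_isConflation {X I Z I' Z' : C} {i : X ⟶ I} {p : I ⟶ Z} {i' : X ⟶ I'}
    {p' : I' ⟶ Z'} (h : E.IsConflation i p) (hI : E.IsInjective I) (h' : E.IsConflation i' p')
    (hI' : E.IsInjective I') : Nonempty (E.toStable.obj Z ≅ E.toStable.obj Z') := by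
  obtain ⟨a, ha⟩ := IsInjective.extend E hI' i ⟨_, _, h⟩ i'
  obtain ⟨a', ha'⟩ := IsInjective.extend E hI i' ⟨_, _, h'⟩ i
  obtain ⟨b, hb⟩ := E.exists_desc h (a ≫ p') (by rw [reassoc_of% ha, h'.zero])
  obtain ⟨b', hb'⟩ := E.exists_desc h' (a' ≫ p) (by rw [reassoc_of% ha', h.zero])
  refine ⟨⟨E.toStable.map b, E.toStable.map b', ?_, ?_⟩⟩
  · rw [← E.toStable.map_comp]
    exact h.toStable_map_eq_id E hI (a := a ≫ a') (by rw [reassoc_of% ha, ha'])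
      (by rw [reassoc_of% hb, hb', Category.assoc])
  · rw [← E.toStable.map_comp]
    exact h'.toStable_map_eq_id E hI' (a := a' ≫ a) (by rw [reassoc_of% ha', ha])
      (by rw [reassoc_of% hb', hb, Category.assoc])

variable {E} in
lemma IsCosyzMap.suspension_map {X Y : C} {f : X ⟶ Y} {b : E.cosyz X ⟶ E.cosyz Y}
    (h : E.IsCosyzMap f b) : E.suspension.map (E.toStable.map f) = E.toStable.map b :=
  CategoryTheory.Quotient.sound _ (IsCosyzMap.stableRel E (E.exists_isCosyzMap f).choose_spec h
    (Congruence.equivalence.refl f))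

/-- Maps between cosyzygies are induced by maps. -/
lemma exists_isCosyzMap_of_cosyz {X Y : C} (b : E.cosyz X ⟶ E.cosyz Y) :
    ∃ f : X ⟶ Y, E.IsCosyzMap f b := by
  obtain ⟨a, ha⟩ := IsProjective.lift E (E.isProjective_inj X) (E.injπ Y)
    ⟨_, _, E.isConflation_inj Y⟩ (E.injπ X ≫ b)
  obtain ⟨f, hf⟩ := (E.isConflation_inj Y).exists_lift (E.injι X ≫ a) (by
    rw [Category.assoc, ha, ← Category.assoc, (E.isConflation_inj X).zero, zero_comp])
  exact ⟨f, a, hf.symm, ha.symm⟩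

variable {E} in
lemma IsCosyzMap.toStable_map_eq_zero {X Y : C} {f : X ⟶ Y} {b : E.cosyz X ⟶ E.cosyz Y}
    (h : E.IsCosyzMap f b) (hb : E.toStable.map b = 0) : E.toStable.map f = 0 := by
  obtain ⟨a, ha, hab⟩ := h
  obtain ⟨t, rfl⟩ := E.exists_lift_of_toStable_map_eq_zero hb ⟨_, _, E.isConflation_inj Y⟩
  -- The correction of a by t takes values in Y and restricts to f on X, so f factors through I(X).
  obtain ⟨r, hr⟩ := (E.isConflation_inj Y).exists_lift (a - E.injπ X ≫ t) (by
    rw [Preadditive.sub_comp, Category.assoc, hab, sub_self])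
  have := (E.isConflation_inj Y).mono
  have hf : f = E.injι X ≫ r := by
    rw [← cancel_mono (E.injι Y), Category.assoc, hr, Preadditive.comp_sub, ha,
      reassoc_of% (E.isConflation_inj X).zero]
    simp
  rw [hf]
  exact E.toStable_map_eq_zero (E.isProjective_inj X) _ _

variable {E} in
lemma IsCosyzMap.sub {X Y : C} {f f' : X ⟶ Y} {b b' : E.cosyz X ⟶ E.cosyz Y}
    (h : E.IsCosyzMap f b) (h' : E.IsCosyzMap f' b') : E.IsCosyzMap (f - f') (b - b') := by
  obtain ⟨a, ha, hb⟩ := h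
  obtain ⟨a', ha', hb'⟩ := h'
  exact ⟨a - a', by simp [ha, ha'], by simp [hb, hb']⟩

variable {E} in
lemma IsCosyzMap.comp {X Y Z : C} {f : X ⟶ Y} {g : Y ⟶ Z} {b : E.cosyz X ⟶ E.cosyz Y}
    {b' : E.cosyz Y ⟶ E.cosyz Z} (h : E.IsCosyzMap f b) (h' : E.IsCosyzMap g b') :
    E.IsCosyzMap (f ≫ g) (b ≫ b') := by
  obtain ⟨a, ha, hb⟩ := h
  obtain ⟨a', ha', hb'⟩ := h'
  exact ⟨a ≫ a', by rw [reassoc_of% ha, ha', Category.assoc],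
    by rw [reassoc_of% hb, hb', Category.assoc]⟩

instance : E.suspension.PreservesZeroMorphisms where
  map_zero X Y := by
    obtain ⟨X⟩ := X
    obtain ⟨Y⟩ := Y
    have h : E.IsCosyzMap (0 : X ⟶ Y) 0 := ⟨0, by simp, by simp⟩
    have := h.suspension_map
    rwa [E.toStable.map_zero, E.toStable.map_zero] at this

instance : E.suspension.Full where
  map_surjective {X Y} g := by
    obtain ⟨X⟩ := X
    obtain ⟨Y⟩ := Y
    obtain ⟨b, rfl⟩ := E.toStable.map_surjective (X := E.cosyz X) (Y := E.cosyz Y) g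
    obtain ⟨f, hf⟩ := E.exists_isCosyzMap_of_cosyz b
    exact ⟨E.toStable.map f, hf.suspension_map⟩

instance : E.suspension.Faithful where
  map_injective {X Y} f g h := by
    obtain ⟨X⟩ := X
    obtain ⟨Y⟩ := Y
    obtain ⟨f, rfl⟩ := E.toStable.map_surjective (X := X) (Y := Y) f
    obtain ⟨g, rfl⟩ := E.toStable.map_surjective (X := X) (Y := Y) g
    obtain ⟨b, hb⟩ := E.exists_isCosyzMap f
    obtain ⟨b', hb'⟩ := E.exists_isCosyzMap g
    rw [hb.suspension_map, hb'.suspension_map] at h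
    have := (hb.sub hb').toStable_map_eq_zero (by rw [E.toStable.map_sub, h, sub_self])
    rwa [E.toStable.map_sub, sub_eq_zero] at this

/-- A projective mapping onto M by a deflation is also injective, so M is a cosyzygy of the kernel.
-/
instance : E.suspension.EssSurj where
  mem_essImage := fun ⟨M⟩ => by
    obtain ⟨P, p, hP, K, i, h⟩ := IsFrobenius.enough_projectives (E := E) M
    obtain ⟨e⟩ := E.nonempty_iso_of_isConflation (E.isConflation_inj K) (E.isInjective_inj K) h
      (IsProjective.isInjective hP)
    exact ⟨E.toStable.obj K, ⟨e⟩⟩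

/-- The standard triangle on a map comes from a conflation. -/
lemma isConflation_of_isPushout_inj {X Y Z : C} {u : X ⟶ Y} {v : Y ⟶ Z} {j : E.inj X ⟶ Z}
    {w : Z ⟶ E.cosyz X} (sq : IsPushout u (E.injι X) v j) (hv : v ≫ w = 0)
    (hj : j ≫ w = E.injπ X) : E.IsConflation v w :=
  (E.isConflation_inj X).of_isPushout sq.flip hv hj

/-- In a standard triangle, the composition of the last map with the suspension of the first map
is stably zero. -/
lemma toStable_map_comp_eq_zero {X Y Z : C} {u : X ⟶ Y} {v : Y ⟶ Z} {j : E.inj X ⟶ Z}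
    {w : Z ⟶ E.cosyz X} (sq : IsPushout u (E.injι X) v j) (hv : v ≫ w = 0)
    (hj : j ≫ w = E.injπ X) {u' : E.cosyz X ⟶ E.cosyz Y} (hu : E.IsCosyzMap u u') :
    E.toStable.map (w ≫ u') = 0 := by
  obtain ⟨a, ha, hb⟩ := hu
  have : w ≫ u' = sq.desc (E.injι Y) a ha.symm ≫ E.injπ Y := sq.hom_ext
    (by rw [reassoc_of% hv, zero_comp, sq.inl_desc_assoc, (E.isConflation_inj Y).zero])
    (by rw [reassoc_of% hj, sq.inr_desc_assoc, hb])
  rw [this]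
  exact E.toStable_map_eq_zero (E.isProjective_inj Y) _ _

variable {E}

/-- The maps `φ : G ⟶ Ω⁻¹ F` which vanish after composition with the suspension of `f : F ⟶ K`
vanish stably, if `f` has the right lifting property with respect to the inflations with
cokernel `G`. -/
lemma IsCosyzMap.toStable_map_eq_zero_of_rlp {F K G : C} {f : F ⟶ K} {u : E.cosyz F ⟶ E.cosyz K}
    (hu : E.IsCosyzMap f u)
    (hf : ∀ ⦃A B : C⦄ (i : A ⟶ B) (p : B ⟶ G), E.IsConflation i p → HasLiftingProperty i f)
    (φ : G ⟶ E.cosyz F) (hφ : E.toStable.map (φ ≫ u) = 0) : E.toStable.map φ = 0 := by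
  obtain ⟨a, ha, hau⟩ := hu
  -- B is the extension of G by F classified by φ. The vanishing of `φ ≫ u` says that the pushout of
  -- B along f splits, that is, f extends to e : B → K.
  obtain ⟨B, γ, q, k, sq, hk, hkγ⟩ := (E.isConflation_inj F).exists_pullback φ
  obtain ⟨n, hn⟩ := E.exists_lift_of_toStable_map_eq_zero hφ ⟨_, _, E.isConflation_inj K⟩
  obtain ⟨e, he⟩ := (E.isConflation_inj K).exists_lift (γ ≫ a - q ≫ n) (by
    rw [Preadditive.sub_comp, Category.assoc, Category.assoc, hn, ← hau, sq.w_assoc, sub_self])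
  have := (E.isConflation_inj K).mono
  have hke : k ≫ e = f := by
    rw [← cancel_mono (E.injι K), Category.assoc, he, Preadditive.comp_sub, reassoc_of% hkγ,
      reassoc_of% hk.zero, ha, zero_comp, sub_zero]
  have := hf k q hk
  -- A lift in this square retracts k. The extension therefore splits, and φ factors through I(F).
  have sq' : CommSq (𝟙 F) k f e := ⟨by rw [Category.id_comp, hke]⟩
  have hl := sq'.fac_left
  obtain ⟨m, hm⟩ := E.exists_desc hk (γ - sq'.lift ≫ E.injι F) (by
    rw [Preadditive.comp_sub, hkγ, reassoc_of% hl, sub_self])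
  have := hk.epi
  have hmφ : φ = m ≫ E.injπ F := by
    rw [← cancel_epi q, reassoc_of% hm, Preadditive.sub_comp, Category.assoc,
      (E.isConflation_inj F).zero, comp_zero, sub_zero, sq.w]
  rw [hmφ]
  exact E.toStable_map_eq_zero (E.isProjective_inj F) _ _

/-- If `f : F ⟶ K` has the right lifting property with respect to all inflations with cokernel `G`
and to `0 ⟶ G`, then all maps from the suspension of `G` to the cone of the suspension of `f` are
stably zero. -/
lemma IsCosyzMap.toStable_map_cone_eq_zero {F K G : C} {f : F ⟶ K}
    {u : E.cosyz F ⟶ E.cosyz K} (hu : E.IsCosyzMap f u)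
    (hf : ∀ ⦃A B : C⦄ (i : A ⟶ B) (p : B ⟶ G), E.IsConflation i p → HasLiftingProperty i f)
    {Z : C} {v : E.cosyz K ⟶ Z} {j : E.inj (E.cosyz F) ⟶ Z} {w : Z ⟶ E.cosyz (E.cosyz F)}
    (sq : IsPushout u (E.injι _) v j) (hv : v ≫ w = 0) (hj : j ≫ w = E.injπ _)
    (g : E.cosyz G ⟶ Z) : E.toStable.map g = 0 := by
  obtain ⟨φ, hφ⟩ := E.exists_isCosyzMap_of_cosyz (g ≫ w)
  obtain ⟨u', hu'⟩ := E.exists_isCosyzMap u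
  have hφ₀ : E.toStable.map φ = 0 := hu.toStable_map_eq_zero_of_rlp hf φ <|
    (hφ.comp hu').toStable_map_eq_zero (by
      rw [Category.assoc, E.toStable.map_comp, E.toStable_map_comp_eq_zero sq hv hj hu', comp_zero])
  have hgw : E.toStable.map (g ≫ w) = 0 := by
    rw [← hφ.suspension_map, hφ₀, E.suspension.map_zero]
    rfl
  obtain ⟨x, hx⟩ := E.exists_lift_of_toStable_map_eq_zero hgw ⟨_, _, E.isConflation_inj _⟩
  -- Modulo a map through an injective, g factors through v.
  obtain ⟨y, hy⟩ := (E.isConflation_of_isPushout_inj sq hv hj).exists_lift (g - x ≫ j) (by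
    rw [Preadditive.sub_comp, Category.assoc, hj, hx, sub_self])
  obtain ⟨ψ, hψ⟩ := E.exists_isCosyzMap_of_cosyz y
  -- The inflation of this conflation is zero, so lifting against it factors ψ through f. Hence y
  -- factors stably through u, and `u ≫ v` is stably zero.
  obtain ⟨N, i, hi⟩ := E.deflation_id G
  have hi : E.IsConflation i (𝟙 G) := hi
  have := hf i _ hi
  have sq' : CommSq (0 : N ⟶ F) i f ψ := ⟨by
    have : i = 0 := by simpa using hi.zero
    rw [this, zero_comp, zero_comp]⟩
  have hl := sq'.fac_right
  obtain ⟨y', hy'⟩ := E.exists_isCosyzMap sq'.lift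
  have hyy' : E.toStable.map y = E.toStable.map (y' ≫ u) := by
    rw [← hψ.suspension_map, ← (hy'.comp hu).suspension_map, hl]
  have huv : E.toStable.map (u ≫ v) = 0 := by
    rw [sq.w]
    exact E.toStable_map_eq_zero (E.isProjective_inj _) _ _
  have hg : g = y ≫ v + x ≫ j := by rw [hy, sub_add_cancel]
  rw [hg, E.toStable.map_add, E.toStable.map_comp y, hyy', ← E.toStable.map_comp, Category.assoc,
    E.toStable.map_comp y', huv, comp_zero, zero_add, E.toStable.map_comp x]
  have := E.toStable_map_eq_zero (E.isProjective_inj _) (x ≫ 𝟙 _) j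
  rwa [Category.comp_id, E.toStable.map_comp] at this

end StableCategory

end ExactStructure

/-- Applied to the suspension, this identifies the shift of the orthogonal of the aisle with the
orthogonal of the shifted aisle. -/
lemma CategoryTheory.ObjectProperty.rightOrthogonal_map {A D : Type*} [Category A] [Category D]
    [HasZeroMorphisms A] [HasZeroMorphisms D] (P : ObjectProperty A) (F : A ⥤ D) [F.Full]
    [F.Faithful] [F.EssSurj] [F.PreservesZeroMorphisms] :
    (P.map F).rightOrthogonal = P.rightOrthogonal.map F := by
  ext Y
  rw [prop_map_iff]
  constructor
  · intro h
    refine ⟨F.objPreimage Y, fun X f hX => F.map_injective ?_, ⟨F.objObjPreimageIso Y⟩⟩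
    have hf : F.map f ≫ (F.objObjPreimageIso Y).hom = 0 := h _ (P.prop_map_obj F hX)
    rw [← cancel_mono (F.objObjPreimageIso Y).hom, hf, F.map_zero, zero_comp]
  · rintro ⟨Y', hY', ⟨e⟩⟩ X f hX
    obtain ⟨X', hX', ⟨e'⟩⟩ := (prop_map_iff _ _ _).1 hX
    obtain ⟨g, hg⟩ := F.map_surjective (e'.hom ≫ f ≫ e.inv)
    rw [hY' g hX', F.map_zero] at hg
    rw [← cancel_epi e'.hom, ← cancel_mono e.inv, Category.assoc, ← hg, comp_zero, zero_comp]

namespace ExactStructure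

/-! ### From lifting properties to t-structures. -/

section TStructure

variable {C : Type u} [Category.{v} C] [Preadditive C] [HasZeroObject C] [HasBinaryBiproducts C]
  {E : ExactStructure C}

lemma isProjective_of_toStable_map_id_eq_zero {Z : C} (h : E.toStable.map (𝟙 Z) = 0) :
    E.IsProjective Z := by
  obtain ⟨P, a, b, hP, hab⟩ := (E.toStable_map_eq_zero_iff _).1 h
  intro Y p hp
  obtain ⟨b', hb'⟩ := IsProjective.lift E hP p hp b
  exact ⟨a ≫ b', by rw [Category.assoc, hb', hab]⟩

variable [E.IsFrobenius]

lemma prop_map_suspension_iff {F : ObjectProperty C} (X : E.Stable) :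
    ((F.map E.toStable).map E.suspension) X ↔
      ∃ G, F G ∧ Nonempty (E.toStable.obj (E.cosyz G) ≅ X) := by
  rw [ObjectProperty.prop_map_iff]
  constructor
  · rintro ⟨X', hX', ⟨e⟩⟩
    obtain ⟨G, hG, ⟨e'⟩⟩ := (ObjectProperty.prop_map_iff _ _ _).1 hX'
    exact ⟨G, hG, ⟨E.suspension.mapIso e' ≪≫ e⟩⟩
  · rintro ⟨G, hG, ⟨e⟩⟩
    exact ⟨_, F.prop_map_obj E.toStable hG, ⟨e⟩⟩

/-- Cosyzygies do not depend stably on the chosen injective. The hypothesis on cosyzygies thus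
becomes one on the suspension. -/
lemma map_suspension_eq (F : ObjectProperty C) :
    (F.map E.toStable).map E.suspension = (E.cosyzygies F).map E.toStable := by
  ext X
  rw [prop_map_suspension_iff, ObjectProperty.prop_map_iff]
  constructor
  · rintro ⟨G, hG, ⟨e⟩⟩
    exact ⟨_, ⟨G, _, _, _, hG, E.isInjective_inj G, E.isConflation_inj G⟩, ⟨e⟩⟩
  · rintro ⟨Z, ⟨G, I, i, p, hG, hI, h⟩, ⟨e⟩⟩
    obtain ⟨e'⟩ := E.nonempty_iso_of_isConflation (E.isConflation_inj G) (E.isInjective_inj G) h hI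
    exact ⟨G, hG, ⟨e' ≪≫ e⟩⟩

/-- If the map from `M` to the cone of a map `X ⟶ M` is stably zero, and if the cone receives no
nonzero stable maps from the suspension of `X`, then `X` and `M` are stably isomorphic. -/
lemma nonempty_iso_of_cone {X M Z : C} {u : X ⟶ M} {v : M ⟶ Z} {j : E.inj X ⟶ Z}
    {w : Z ⟶ E.cosyz X} (sq : IsPushout u (E.injι X) v j) (hv : v ≫ w = 0)
    (hj : j ≫ w = E.injπ X) (hv₀ : E.toStable.map v = 0)
    (hZ : ∀ r : E.cosyz X ⟶ Z, E.toStable.map r = 0) :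
    Nonempty (E.toStable.obj X ≅ E.toStable.obj M) := by
  have hc := E.isConflation_of_isPushout_inj sq hv hj
  obtain ⟨N, s, t, hN, hst⟩ := (E.toStable_map_eq_zero_iff v).1 hv₀
  obtain ⟨s', hs'⟩ := IsInjective.extend E (IsProjective.isInjective hN) v ⟨_, _, hc⟩ s
  -- Modulo projectives the identity of Z factors through w, hence through a map Ω⁻¹X → Z, and those
  -- are stably zero. So Z is projective, thus injective, and Ω⁻¹X becomes a cosyzygy of M.
  obtain ⟨r, hr⟩ := E.exists_desc hc (𝟙 Z - s' ≫ t) (by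
    rw [Preadditive.comp_sub, reassoc_of% hs', ← hst, Category.comp_id, sub_self])
  have hid : E.IsProjective Z := isProjective_of_toStable_map_id_eq_zero (by
    have : 𝟙 Z = w ≫ r + s' ≫ t := by rw [hr, sub_add_cancel]
    rw [this, E.toStable.map_add, E.toStable_map_eq_zero hN, E.toStable.map_comp, hZ, comp_zero,
      add_zero])
  obtain ⟨e⟩ := E.nonempty_iso_of_isConflation hc (IsProjective.isInjective hid)
    (E.isConflation_inj M) (E.isInjective_inj M)
  exact ⟨E.suspension.preimageIso (X := E.toStable.obj X) (Y := E.toStable.obj M) e⟩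

/-- A class `F` with `Ω⁻¹ F ⊆ F` is the aisle of a t-structure if every object receives a map from
an object of `F` with the right lifting property with respect to the inflations with cokernels in
`F`. -/
theorem isTStructure_of_rlp {F : ObjectProperty C}
    (hF : (E.cosyzygies F).map E.toStable ≤ F.map E.toStable)
    (hrlp : ∀ K : C, ∃ (X : C) (f : X ⟶ K), F X ∧
      (E.inflationsWithCokernelIn F).rlp f) :
    E.IsTStructure (F.map E.toStable) ((F.map E.toStable).rightOrthogonal.map E.suspension) := by
  rw [← map_suspension_eq] at hF
  rw [← ObjectProperty.rightOrthogonal_map]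
  -- The cone is taken on the suspension of f, rather than on f, so that the triangle begins with
  -- X[1] and needs no rotation.
  have htri (K : C) : ∃ (X : C) (u : E.cosyz X ⟶ E.cosyz K) (Z : C) (v : E.cosyz K ⟶ Z)
      (j : E.inj (E.cosyz X) ⟶ Z) (w : Z ⟶ E.cosyz (E.cosyz X)), F X ∧
      IsPushout u (E.injι _) v j ∧ v ≫ w = 0 ∧ j ≫ w = E.injπ _ ∧
      ((F.map E.toStable).map E.suspension).rightOrthogonal (E.toStable.obj Z) := by
    obtain ⟨X, f, hX, hf⟩ := hrlp K
    obtain ⟨u, hu⟩ := E.exists_isCosyzMap f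
    obtain ⟨Z, j, v, w, sq, hc, hj⟩ := (E.isConflation_inj (E.cosyz X)).exists_pushout u
    refine ⟨X, u, Z, v, j, w, hX, sq.flip, hc.zero, hj, fun T g hT => ?_⟩
    obtain ⟨G, hG, ⟨e⟩⟩ := (prop_map_suspension_iff T).1 hT
    obtain ⟨g', hg'⟩ := E.toStable.map_surjective (e.hom ≫ g)
    rw [← cancel_epi e.hom, ← hg', comp_zero]
    exact hu.toStable_map_cone_eq_zero (fun A B i p hi => hf i ⟨G, p, hi, hG⟩) sq.flip hc.zero hj g'
  refine ⟨rfl, le_antisymm (fun X hX Y f hY => hY f hX) fun M hM => ?_, hF, fun M => ?_⟩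
  · obtain ⟨⟨K⟩, ⟨e⟩⟩ := Functor.EssSurj.mem_essImage E.suspension M
    have e : E.toStable.obj (E.cosyz K) ≅ M := e
    obtain ⟨X, u, Z, v, j, w, hX, sq, hv, hj, hZ⟩ := htri K
    have hv₀ : E.toStable.map v = 0 := by
      have := hM (e.inv ≫ E.toStable.map v) hZ
      rwa [← cancel_epi e.inv, comp_zero]
    -- Here closure under suspension enters: Ω⁻¹X is stably in F, so Ω⁻²X lies in F[1] and has no
    -- nonzero stable maps to Z.
    obtain ⟨e'⟩ := nonempty_iso_of_cone sq hv hj hv₀ fun r => hZ _ (ObjectProperty.prop_map_obj _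
      E.suspension (hF _ (ObjectProperty.prop_map_obj _ E.suspension (F.prop_map_obj _ hX))))
    exact (prop_map_suspension_iff M).2 ⟨X, hX, ⟨e' ≪≫ e⟩⟩
  · obtain ⟨⟨K⟩, ⟨e⟩⟩ := Functor.EssSurj.mem_essImage E.suspension M
    have e : E.toStable.obj (E.cosyz K) ≅ M := e
    obtain ⟨X, u, Z, v, j, w, hX, sq, hv, hj, hZ⟩ := htri K
    refine ⟨E.toStable.obj X, E.toStable.obj Z, E.toStable.map u ≫ e.hom,
      e.inv ≫ E.toStable.map v, E.toStable.map w, F.prop_map_obj _ hX, hZ, E.cosyz X, E.cosyz K, Z,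
      u, v, j, w, Iso.refl _, e.symm, Iso.refl _, sq, hv, hj, ?_, ?_, ?_⟩
    · exact (show (E.toStable.map u ≫ e.hom) ≫ e.inv = _ by simp).trans (Category.id_comp _).symm
    · simp
    · exact (congrArg _ (E.suspension.map_id _)).trans
        ((Category.comp_id _).trans (Category.id_comp _).symm)

end TStructure

end ExactStructure

theorem mainTheorem8 {C : Type u} [Category.{v} C] [Preadditive C] [HasZeroObject C]
    [HasBinaryBiproducts C] (E E' : ExactStructure C) (hEE' : E.conflation ≤ E'.conflation)
    (hE' : E'.IsEfficient) [E.IsFrobenius]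
    (S : ObjectProperty C) [ObjectProperty.Small.{v} S] :
    ((E.cosyzygies (E'.filt S)).map E.toStable ≤ (E'.filt S).map E.toStable →
      E.IsTStructure ((E'.filt S).map E.toStable)
        (((E'.filt S).map E.toStable).rightOrthogonal.map E.suspension)) ∧
    ((E.cosyzygies (E'.filt S)).map E.toStable = (E'.filt S).map E.toStable →
      E.IsBousfieldLocalizingPair ((E'.filt S).map E.toStable)
        (((E'.filt S).map E.toStable).rightOrthogonal.map E.suspension)) := by
  have hrlp (K : C) : ∃ (X : C) (f : X ⟶ K), E'.filt S X ∧
      (E.inflationsWithCokernelIn (E'.filt S)).rlp f := by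
    obtain ⟨X, f, hX, hf⟩ := hE'.exists_filt_rlp S K
    refine ⟨X, f, hX, fun A B i ⟨Z, p, ⟨w, h⟩, hZ⟩ => ?_⟩
    -- The two exact structures meet here: a conflation of `E` is one of `E'`, where the lifting
    -- property is available.
    exact ExactStructure.IsConflation.hasLiftingProperty ⟨w, hEE' _ h⟩ hZ hf
  exact ⟨fun h => ExactStructure.isTStructure_of_rlp h hrlp, fun h =>
    { toIsTStructure := ExactStructure.isTStructure_of_rlp h.le hrlp
      eq_shift := by rw [ExactStructure.map_suspension_eq, h] }⟩
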